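/- Let $\mathcal G$ be a locally finite, connected metric tree with countably many edges: each edge $e$ is an interval $[0,\ell_e]$ with $0<\ell_e<\infty$, the intervals are glued at their endpoints, and the resulting graph has no cycles. A vertex of degree two is called a dummy vertex; a maximal unbranched segment of $\mathcal G$ is a class of edges under the equivalence relation generated by sharing a dummy vertex, and its length is the sum of the lengths of its edges. (If there are no dummy vertices, the segments are exactly the edges.) Let $\mathfrak C(\mathcal G)$ be the set of topological ends of $\mathcal G$ and put $$\mathfrak V=\mathfrak C(\mathcal G)\cup\{v : v \text{ a vertex with } \deg v=1\}.$$ Let $H^1(\mathcal G)$ be the space of continuous functions $f$ on $\mathcal G$ that are absolutely continuous on every edge with $\|f\|_{H^1}^2=\sum_e\int_0^{\ell_e}(|f|^2+|f'|^2)\,dx<\infty$, let $H^1_0(\mathcal G;\mathfrak V)$ be the subspace of all $f\in H^1(\mathcal G)$ that vanish at every element of $\mathfrak V$ (at an end: $f(x)\to0$ as $x$ tends to the end), and let $\mathcal H_{\mathfrak V}$ be the self-adjoint operator in $L^2(\mathcal G)$ associated with the quadratic form $f\mapsto\int_{\mathcal G}|f'|^2\,dx$ with domain $H^1_0(\mathcal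 G;\mathfrak V)$. Suppose that every maximal unbranched segment has finite length and that for every $\varepsilon>0$ only finitely many of them are longer than $\varepsilon$. (If $\mathcal G$ has at most finitely many dummy vertices, this says precisely that for every $\varepsilon>0$ only finitely many edges are longer than $\varepsilon$.) Then the embedding of $H^1_0(\mathcal G;\mathfrak V)$ into $L^2(\mathcal G)$ is compact, and $\mathcal H_{\mathfrak V}$ has purely discrete spectrum, i.e. its spectrum consists of isolated eigenvalues of finite multiplicity. This holds for real-valued as well as for complex-valued functions. -/

import Mathlib

open MeasureTheory Set Filter Topology
open scoped ENNReal InnerProductSpace ContDiff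

noncomputable section

/-! ### Metric graphs -/

/-- A metric graph with vertex set `V` and edge set `E`: every edge `e` is an interval
`[0, length e]` of finite positive length, and `endpoint e false`, `endpoint e true` are the
vertices to which its endpoints `0` and `length e` are glued. Loops and parallel edges are
allowed. Vertices are classes of endpoints, so every vertex is an endpoint of some edge. -/
structure MetricGraph (V E : Type*) where
  length : E → ℝ
  length_pos : ∀ e, 0 < length e
  endpoint : E → Bool → V
  exists_endpoint : ∀ v, ∃ e b, endpoint e b = v

namespace MetricGraph

variable {V E : Type*} (G : MetricGraph V E)

/-- The set of edge ends glued to the vertex `v` (a loop contributes two of them). -/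
def edgeEnds (v : V) : Set (E × Bool) := {p | G.endpoint p.1 p.2 = v}

/-- The degree of a vertex; loops are counted twice. -/
def degree (v : V) : ℕ∞ := (G.edgeEnds v).encard

/-- Every vertex has finite degree. -/
def LocallyFinite : Prop := ∀ v, (G.edgeEnds v).Finite

/-- The simple graph of adjacent (distinct) vertices. -/
def adjacency : SimpleGraph V :=
  SimpleGraph.fromRel fun v w => ∃ e, G.endpoint e false = v ∧ G.endpoint e true = w

/-- `G` is a tree: it is connected and has no cycles. Loops are the cycles of length one, pairs of
parallel edges are the cycles of length two, all other cycles are seen by the adjacency graph. -/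
structure IsTree : Prop where
  no_loops : ∀ e, G.endpoint e false ≠ G.endpoint e true
  no_parallel : ∀ e e', s(G.endpoint e false, G.endpoint e true) =
    s(G.endpoint e' false, G.endpoint e' true) → e = e'
  isTree : G.adjacency.IsTree

/-- Two edges are joined at a dummy vertex, that is, at a vertex of degree two. -/
def JoinedAtDummy (e e' : E) : Prop :=
  ∃ v b b', G.degree v = 2 ∧ G.endpoint e b = v ∧ G.endpoint e' b' = v

/-- The maximal unbranched segments: the edges that remain after all dummy vertices are removed.
They are the classes of the equivalence relation generated by `JoinedAtDummy`. -/
def Segment : Type _ := Quot G.JoinedAtDummy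

/-- The length of a segment: the total length of the edges it consists of. -/
def segmentLength (s : G.Segment) : ℝ≥0∞ :=
  ∑' e : {e : E // Quot.mk G.JoinedAtDummy e = s}, ENNReal.ofReal (G.length e)

/-! ### The topological space and its ends -/

/-- The endpoint `0` (for `false`) or `length e` (for `true`) of the edge `e`. -/
def endCoord (e : E) (b : Bool) : Icc (0 : ℝ) (G.length e) :=
  if b then ⟨G.length e, (G.length_pos e).le, le_rfl⟩ else ⟨0, le_rfl, (G.length_pos e).le⟩

/-- The gluing of edge ends that belong to the same vertex. -/
def Glue (p q : Σ e, Icc (0 : ℝ) (G.length e)) : Prop :=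
  ∃ e b e' b', p = ⟨e, G.endCoord e b⟩ ∧ q = ⟨e', G.endCoord e' b'⟩ ∧
    G.endpoint e b = G.endpoint e' b'

/-- The points of the metric graph: the disjoint union of the edges `[0, length e]`, glued at the
vertices. -/
def Point : Type _ := Quot G.Glue

/-- The point with coordinate `x` on the edge `e`. -/
def pt (e : E) (x : Icc (0 : ℝ) (G.length e)) : G.Point := Quot.mk G.Glue ⟨e, x⟩

/-- For locally finite graphs this quotient topology is the one of the path metric. -/
instance : TopologicalSpace G.Point := inferInstanceAs (TopologicalSpace (Quot G.Glue))

/-- The parametrization of the edge `e` by `[0, length e]` (constant outside). -/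
def edgeMap (e : E) (x : ℝ) : G.Point :=
  G.pt e (projIcc 0 (G.length e) (G.length_pos e).le x)

/-- The sequences of sets that represent a topological end. -/
structure EndRep where
  U : ℕ → Set G.Point
  isOpen : ∀ n, IsOpen (U n)
  isConnected : ∀ n, IsConnected (U n)
  isCompact_frontier : ∀ n, IsCompact (frontier (U n))
  succ_subset : ∀ n, U (n + 1) ⊆ U n
  iInter_closure : ⋂ n, closure (U n) = ∅

/-- Two sequences are equivalent if each set of one contains a set of the other. -/
instance EndRep.setoid : Setoid G.EndRep where
  r A B := ∀ n, (∃ j, B.U j ⊆ A.U n) ∧ ∃ k, A.U k ⊆ B.U n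
  iseqv :=
    { refl := fun _ n => ⟨⟨n, Subset.rfl⟩, n, Subset.rfl⟩
      symm := fun h n => ⟨(h n).2, (h n).1⟩
      trans := by
        intro A B C h h' n
        refine ⟨?_, ?_⟩
        · obtain ⟨j, hj⟩ := (h n).1
          obtain ⟨k, hk⟩ := (h' j).1
          exact ⟨k, hk.trans hj⟩
        · obtain ⟨j, hj⟩ := (h' n).2
          obtain ⟨k, hk⟩ := (h j).2
          exact ⟨k, hk.trans hj⟩ }

/-- The topological ends of `G`. -/
def TopEnd : Type _ := Quotient (EndRep.setoid G)

variable {G}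

/-- The filter of neighbourhoods (in `G`) of an end. -/
def TopEnd.nhds (γ : G.TopEnd) : Filter G.Point :=
  Quotient.lift (fun A : G.EndRep => ⨅ n, 𝓟 (A.U n)) (by
    intro A B h
    refine le_antisymm (le_iInf fun n => ?_) (le_iInf fun n => ?_)
    · obtain ⟨k, hk⟩ := (h n).2
      exact (iInf_le _ k).trans (principal_mono.2 hk)
    · obtain ⟨k, hk⟩ := (h n).1
      exact (iInf_le _ k).trans (principal_mono.2 hk)) γ

variable (G)

/-! ### Function spaces -/

variable (𝕜 : Type*) [RCLike 𝕜]

/-- Lebesgue measure on the edge `e`. -/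
def edgeMeasure (e : E) : Measure ℝ := volume.restrict (Ioo 0 (G.length e))

/-- `L²(G)`: the Hilbert direct sum of the spaces `L²(0, length e)`. -/
abbrev L2 : Type _ := lp (fun e : E => Lp 𝕜 2 (G.edgeMeasure e)) 2

/-- Pairs of `L²` functions, with `‖(u, w)‖² = ‖u‖² + ‖w‖²`. -/
abbrev L2Pair : Type _ := WithLp 2 (G.L2 𝕜 × G.L2 𝕜)

variable {𝕜}

/-- `f` is a continuous function on `G` which is absolutely continuous on every edge; as elements
of `L²(G)`, the function `f` is `p.fst` and its derivative `f'` is `p.snd`. -/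
structure IsSobolev (f : G.Point → 𝕜) (p : G.L2Pair 𝕜) : Prop where
  continuous : Continuous f
  ae_eq : ∀ e, (p.fst e : ℝ → 𝕜) =ᵐ[G.edgeMeasure e] fun x => f (G.edgeMap e x)
  eq_integral : ∀ e, ∀ x ∈ Icc 0 (G.length e),
    f (G.edgeMap e x) = f (G.edgeMap e 0) + ∫ t in 0..x, p.snd e t

/-- `f` vanishes at all vertices and ends in `𝔙` (at an end: its limit there exists and is `0`). -/
structure VanishesOn (𝔙 : Set (V ⊕ G.TopEnd)) (f : G.Point → 𝕜) : Prop where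
  vertex : ∀ e b, Sum.inl (G.endpoint e b) ∈ 𝔙 → f (G.pt e (G.endCoord e b)) = 0
  topEnd : ∀ γ, Sum.inr γ ∈ 𝔙 → Tendsto f γ.nhds (𝓝 0)

variable {G}

theorem intervalIntegrable_coe {e : E} (w : Lp 𝕜 2 (G.edgeMeasure e)) {x : ℝ}
    (hx : x ∈ Icc 0 (G.length e)) : IntervalIntegrable w volume 0 x := by
  have : IsFiniteMeasure (G.edgeMeasure e) := by unfold edgeMeasure; infer_instance
  have h : Integrable w (G.edgeMeasure e) := (Lp.memLp w).integrable (by norm_num)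
  rw [intervalIntegrable_iff_integrableOn_Ioo_of_le hx.1]
  exact IntegrableOn.mono_set (t := Ioo 0 (G.length e)) h (Ioo_subset_Ioo le_rfl hx.2)

theorem intervalIntegral_congr_edge {e : E} {w w' : ℝ → 𝕜} (h : w =ᵐ[G.edgeMeasure e] w') {x : ℝ}
    (hx : x ∈ Icc 0 (G.length e)) : ∫ t in 0..x, w t = ∫ t in 0..x, w' t := by
  rw [intervalIntegral.integral_of_le hx.1, intervalIntegral.integral_of_le hx.1,
    integral_Ioc_eq_integral_Ioo, integral_Ioc_eq_integral_Ioo]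
  exact integral_congr_ae
    (ae_restrict_of_ae_restrict_of_subset (Ioo_subset_Ioo le_rfl hx.2) h)

theorem IsSobolev.add {f g : G.Point → 𝕜} {p q : G.L2Pair 𝕜} (hf : G.IsSobolev f p)
    (hg : G.IsSobolev g q) : G.IsSobolev (f + g) (p + q) where
  continuous := hf.continuous.add hg.continuous
  ae_eq e := by
    filter_upwards [hf.ae_eq e, hg.ae_eq e, Lp.coeFn_add (p.fst e) (q.fst e)] with x h1 h2 h3
    change (p.fst e + q.fst e : Lp 𝕜 2 (G.edgeMeasure e)) x = _
    rw [h3, Pi.add_apply, h1, h2]; rfl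
  eq_integral e x hx := by
    have h := intervalIntegral_congr_edge (Lp.coeFn_add (p.snd e) (q.snd e)) hx
    change f _ + g _ = f _ + g _ +
      ∫ t in 0..x, (p.snd e + q.snd e : Lp 𝕜 2 (G.edgeMeasure e)) t
    rw [h]
    simp only [Pi.add_apply]
    rw [intervalIntegral.integral_add (intervalIntegrable_coe _ hx) (intervalIntegrable_coe _ hx),
      hf.eq_integral e x hx, hg.eq_integral e x hx]
    ring

theorem IsSobolev.smul (c : 𝕜) {f : G.Point → 𝕜} {p : G.L2Pair 𝕜} (hf : G.IsSobolev f p) :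
    G.IsSobolev (c • f) (c • p) where
  continuous := hf.continuous.const_smul c
  ae_eq e := by
    filter_upwards [hf.ae_eq e, Lp.coeFn_smul c (p.fst e)] with x h1 h3
    change (c • p.fst e : Lp 𝕜 2 (G.edgeMeasure e)) x = _
    rw [h3, Pi.smul_apply, h1]; rfl
  eq_integral e x hx := by
    have h := intervalIntegral_congr_edge (Lp.coeFn_smul c (p.snd e)) hx
    change c • f _ = c • f _ + ∫ t in 0..x, (c • p.snd e : Lp 𝕜 2 (G.edgeMeasure e)) t
    rw [h]
    simp only [Pi.smul_apply]
    rw [intervalIntegral.integral_smul, hf.eq_integral e x hx, smul_add]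

theorem IsSobolev.zero : G.IsSobolev (0 : G.Point → 𝕜) 0 where
  continuous := continuous_const
  ae_eq e := Lp.coeFn_zero 𝕜 2 (G.edgeMeasure e)
  eq_integral e x hx := by
    have h := intervalIntegral_congr_edge (Lp.coeFn_zero 𝕜 2 (G.edgeMeasure e)) hx
    change (0 : 𝕜) = 0 + ∫ t in 0..x, (0 : Lp 𝕜 2 (G.edgeMeasure e)) t
    rw [h]; simp

variable (G 𝕜)

/-- The Sobolev space `H¹₀(G; 𝔙)` of all `H¹` functions that vanish on `𝔙`, where a function `f` is
represented by the pair `(f, f')`, so that the norm is the `H¹` norm. -/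
def H10 (𝔙 : Set (V ⊕ G.TopEnd)) : Submodule 𝕜 (G.L2Pair 𝕜) where
  carrier := {p | ∃ f : G.Point → 𝕜, G.IsSobolev f p ∧ G.VanishesOn 𝔙 f}
  add_mem' := by
    rintro p q ⟨f, hf, hf'⟩ ⟨g, hg, hg'⟩
    refine ⟨f + g, hf.add hg, ⟨fun e b h => ?_, fun γ h => ?_⟩⟩
    · rw [Pi.add_apply, hf'.vertex e b h, hg'.vertex e b h, add_zero]
    · have := (hf'.topEnd γ h).add (hg'.topEnd γ h)
      rwa [add_zero] at this
  zero_mem' := ⟨0, .zero, ⟨fun _ _ _ => rfl, fun _ _ => tendsto_const_nhds⟩⟩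
  smul_mem' := by
    rintro c p ⟨f, hf, hf'⟩
    refine ⟨c • f, hf.smul c, ⟨fun e b h => ?_, fun γ h => ?_⟩⟩
    · rw [Pi.smul_apply, hf'.vertex e b h, smul_zero]
    · have := (hf'.topEnd γ h).const_smul c
      rwa [smul_zero] at this

/-- The embedding of `H¹₀(G; 𝔙)` into `L²(G)`. -/
def embedding (𝔙 : Set (V ⊕ G.TopEnd)) : G.H10 𝕜 𝔙 →ₗ[𝕜] G.L2 𝕜 :=
  WithLp.fstₗ 2 𝕜 (G.L2 𝕜) (G.L2 𝕜) ∘ₗ (G.H10 𝕜 𝔙).subtype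

/-- The graph of the operator associated with the form `∫ |f'|²` on `H¹₀(G; 𝔙)`: it consists of the
pairs `(f, g)` with `f` in the form domain and `∫ φ' f' = ∫ φ g` (one factor conjugated) for all
`φ` in the form domain. -/
def laplacianGraph (𝔙 : Set (V ⊕ G.TopEnd)) : Submodule 𝕜 (G.L2 𝕜 × G.L2 𝕜) where
  carrier := {q | ∃ p ∈ G.H10 𝕜 𝔙, p.fst = q.1 ∧
    ∀ φ ∈ G.H10 𝕜 𝔙, ⟪φ.snd, p.snd⟫_𝕜 = ⟪φ.fst, q.2⟫_𝕜}
  add_mem' := by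
    rintro q q' ⟨p, hp, h1, h2⟩ ⟨p', hp', h1', h2'⟩
    refine ⟨p + p', add_mem hp hp', by simp [h1, h1'], fun φ hφ => ?_⟩
    simp [inner_add_right, h2 φ hφ, h2' φ hφ]
  zero_mem' := ⟨0, zero_mem _, rfl, fun φ _ => by simp⟩
  smul_mem' := by
    rintro c q ⟨p, hp, h1, h2⟩
    refine ⟨c • p, Submodule.smul_mem _ _ hp, by simp [h1], fun φ hφ => ?_⟩
    simp [inner_smul_right, h2 φ hφ]

/-- The Laplacian `H_𝔙`: the operator in `L²(G)` associated with the form `∫ |f'|²` on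
`H¹₀(G; 𝔙)`, that is, the operator whose graph is `laplacianGraph` (see `laplacian_graph`). -/
def laplacian (𝔙 : Set (V ⊕ G.TopEnd)) : G.L2 𝕜 →ₗ.[𝕜] G.L2 𝕜 :=
  (G.laplacianGraph 𝕜 𝔙).toLinearPMap

variable {G 𝕜}

theorem continuous_pt (e : E) : Continuous (G.pt e) :=
  continuous_quot_mk.comp continuous_sigmaMk

theorem continuous_edgeMap (e : E) : Continuous (G.edgeMap e) :=
  (continuous_pt e).comp continuous_projIcc

/-- The function on `G` that equals `g` on the edge `e` and vanishes on all other edges. -/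
def bump (e : E) (g : ℝ → ℝ) (h0 : g 0 = 0) (h1 : g (G.length e) = 0) : G.Point → 𝕜 := by
  classical
  exact Quot.lift (fun p => if p.1 = e then ((g p.2 : ℝ) : 𝕜) else 0) (by
    have key : ∀ e' b, (if e' = e then ((g (G.endCoord e' b) : ℝ) : 𝕜) else 0) = 0 := by
      intro e' b
      split_ifs with h
      · subst h
        cases b <;> simp [endCoord, h0, h1]
      · rfl
    rintro p q ⟨e₁, b₁, e₂, b₂, rfl, rfl, -⟩
    exact (key e₁ b₁).trans (key e₂ b₂).symm)

theorem bump_pt_self (e : E) (g : ℝ → ℝ) (h0 : g 0 = 0) (h1 : g (G.length e) = 0)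
    (x : Icc (0 : ℝ) (G.length e)) : bump (𝕜 := 𝕜) e g h0 h1 (G.pt e x) = (g x : ℝ) := by
  classical
  change (if e = e then ((g x : ℝ) : 𝕜) else 0) = _
  simp

theorem bump_pt_ne (e : E) (g : ℝ → ℝ) (h0 : g 0 = 0) (h1 : g (G.length e) = 0) {e' : E}
    (h : e' ≠ e) (x : Icc (0 : ℝ) (G.length e')) :
    bump (𝕜 := 𝕜) e g h0 h1 (G.pt e' x) = 0 := by
  classical
  change (if e' = e then ((g x : ℝ) : 𝕜) else 0) = _
  simp [h]

/-- Smooth functions supported inside an edge belong to `H¹₀(G; 𝔙)`, for every `𝔙`. -/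
theorem exists_bump_mem_H10 (𝔙 : Set (V ⊕ G.TopEnd)) (e : E) (g : ℝ → ℝ)
    (hg : ContDiff ℝ ∞ g) (hgc : HasCompactSupport g) (hgs : tsupport g ⊆ Ioo 0 (G.length e)) :
    ∃ p ∈ G.H10 𝕜 𝔙, (∃ u : Lp 𝕜 2 (G.edgeMeasure e),
      (u =ᵐ[G.edgeMeasure e] fun x => ((g x : ℝ) : 𝕜)) ∧
        ∀ q : G.L2 𝕜, ⟪p.fst, q⟫_𝕜 = ⟪u, q e⟫_𝕜) := by
  classical
  have hz : ∀ x, x ∉ Ioo 0 (G.length e) → g x = 0 := fun x hx =>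
    image_eq_zero_of_notMem_tsupport fun h => hx (hgs h)
  have h0 : g 0 = 0 := hz 0 (by simp)
  have h1 : g (G.length e) = 0 := hz _ (by simp)
  have hg1 : ContDiff ℝ 1 g := hg.of_le (by exact_mod_cast le_top)
  have hd : Continuous (deriv g) := hg1.continuous_deriv le_rfl
  have hu : MemLp (fun x => ((g x : ℝ) : 𝕜)) 2 (G.edgeMeasure e) :=
    ((hg.continuous.memLp_of_hasCompactSupport hgc).ofReal).restrict _
  have hw : MemLp (fun x => ((deriv g x : ℝ) : 𝕜)) 2 (G.edgeMeasure e) :=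
    ((hd.memLp_of_hasCompactSupport hgc.deriv).ofReal).restrict _
  have hf : Continuous (bump (𝕜 := 𝕜) e g h0 h1) := by
    refine continuous_quot_lift _ (continuous_sigma fun e' => ?_)
    by_cases h : e' = e
    · subst h
      simp only [if_true]
      exact RCLike.continuous_ofReal.comp (hg.continuous.comp continuous_subtype_val)
    · simpa [h] using continuous_const
  refine ⟨WithLp.toLp 2 (lp.single 2 e (hu.toLp _), lp.single 2 e (hw.toLp _)),
    ⟨bump e g h0 h1, ⟨hf, fun e' => ?_, fun e' x hx => ?_⟩, ⟨fun e' b _ => ?_, fun γ _ => ?_⟩⟩,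
    hu.toLp _, hu.coeFn_toLp, fun q => lp.inner_single_left _ _ _⟩
  · by_cases h : e' = e
    · subst h
      have hx : ∀ᵐ x ∂(G.edgeMeasure e'), x ∈ Ioo 0 (G.length e') :=
        ae_restrict_mem measurableSet_Ioo
      simp only [WithLp.toLp_fst, lp.single_apply_self]
      filter_upwards [hu.coeFn_toLp, hx] with x hx1 hx2
      rw [hx1, edgeMap, bump_pt_self, projIcc_of_mem _ (Ioo_subset_Icc_self hx2)]
    · simp only [WithLp.toLp_fst, lp.single_apply_ne _ _ _ h]
      filter_upwards [Lp.coeFn_zero 𝕜 2 (G.edgeMeasure e')] with x hx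
      rw [hx, edgeMap, bump_pt_ne _ _ _ _ h]; rfl
  · by_cases h : e' = e
    · subst h
      simp only [WithLp.toLp_snd, lp.single_apply_self]
      have hI : ∫ t in 0..x, ((deriv g t : ℝ) : 𝕜) = ((g x - g 0 : ℝ) : 𝕜) := by
        rw [← intervalIntegral.integral_deriv_eq_sub
          (fun y _ => (hg1.differentiable (by norm_num)).differentiableAt)
          (hd.intervalIntegrable _ _), intervalIntegral.integral_of_le hx.1,
          intervalIntegral.integral_of_le hx.1, integral_ofReal]
      rw [intervalIntegral_congr_edge hw.coeFn_toLp hx, edgeMap, edgeMap, bump_pt_self,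
        bump_pt_self, projIcc_of_mem _ hx, projIcc_left, hI, h0]
      simp
    · simp only [WithLp.toLp_snd, lp.single_apply_ne _ _ _ h]
      rw [intervalIntegral_congr_edge (Lp.coeFn_zero 𝕜 2 (G.edgeMeasure e')) hx, edgeMap, edgeMap,
        bump_pt_ne _ _ _ _ h, bump_pt_ne _ _ _ _ h]
      simp
  · by_cases h : e' = e
    · subst h
      rw [bump_pt_self]
      cases b <;> simp [endCoord, h0, h1]
    · exact bump_pt_ne _ _ _ _ h _
  · induction γ using Quotient.inductionOn with
    | h A =>
      have hK : IsCompact (G.edgeMap e '' tsupport g) :=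
        hgc.isCompact.image (continuous_edgeMap e)
      obtain ⟨n, hn⟩ := hK.elim_directed_family_closed (fun n => closure (A.U n))
        (fun n => isClosed_closure) (by simp [A.iInter_closure])
        (directed_of_isDirected_le fun i j hij =>
          closure_mono (antitone_nat_of_succ_le A.succ_subset hij))
      refine tendsto_const_nhds.congr' ?_
      have hmem : A.U n ∈ TopEnd.nhds (⟦A⟧ : G.TopEnd) :=
        mem_iInf_of_mem n (mem_principal_self _)
      filter_upwards [hmem] with y hy
      induction y using Quot.ind with
      | mk p =>
        obtain ⟨e', x⟩ := p
        change (0 : 𝕜) = bump e g h0 h1 (G.pt e' x)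
        by_cases h : e' = e
        · subst h
          rw [bump_pt_self, eq_comm]
          by_contra hne
          have hx : (x : ℝ) ∈ tsupport g :=
            subset_tsupport _ fun h => hne (by rw [h]; simp)
          have : G.edgeMap e' x ∈ G.edgeMap e' '' tsupport g ∩ closure (A.U n) := by
            refine ⟨mem_image_of_mem _ hx, subset_closure ?_⟩
            rw [edgeMap, projIcc_val]
            exact hy
          rw [hn] at this
          exact this
        · exact (bump_pt_ne _ _ _ _ h _).symm

/-- The function determines its derivative. -/
theorem snd_eq_zero_of_mem_H10 {𝔙 : Set (V ⊕ G.TopEnd)} {p : G.L2Pair 𝕜} (hp : p ∈ G.H10 𝕜 𝔙)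
    (h : p.fst = 0) : p.snd = 0 := by
  obtain ⟨f, hf, -⟩ := hp
  ext1
  funext e
  have hcont : Continuous fun x => f (G.edgeMap e x) := hf.continuous.comp (continuous_edgeMap e)
  have hae : (fun x => f (G.edgeMap e x)) =ᵐ[volume.restrict (Ioo 0 (G.length e))] 0 := by
    have h1 := hf.ae_eq e
    rw [h] at h1
    exact h1.symm.trans (Lp.coeFn_zero 𝕜 2 (G.edgeMeasure e))
  have hIcc : EqOn (fun x => f (G.edgeMap e x)) 0 (Icc 0 (G.length e)) := by
    have := (Measure.eqOn_open_of_ae_eq hae isOpen_Ioo hcont.continuousOn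
      continuousOn_const).closure hcont continuous_const
    rwa [closure_Ioo (G.length_pos e).ne] at this
  have hint : ∀ x ∈ Icc 0 (G.length e), ∫ t in 0..x, p.snd e t = 0 := by
    intro x hx
    have h2 := hf.eq_integral e x hx
    have h3 : f (G.edgeMap e x) = 0 := hIcc hx
    have h4 : f (G.edgeMap e 0) = 0 := hIcc ⟨le_rfl, (G.length_pos e).le⟩
    rw [h3, h4, zero_add] at h2
    exact h2.symm
  have hL := (intervalIntegrable_coe (p.snd e)
    ⟨(G.length_pos e).le, le_rfl⟩).ae_hasDerivAt_integral
  apply Lp.ext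
  refine EventuallyEq.trans ?_ (Lp.coeFn_zero 𝕜 2 (G.edgeMeasure e)).symm
  have hmem : ∀ᵐ x ∂(G.edgeMeasure e), x ∈ Ioo 0 (G.length e) :=
    ae_restrict_mem measurableSet_Ioo
  filter_upwards [ae_restrict_of_ae hL, hmem] with x hx hx'
  rw [uIcc_of_le (G.length_pos e).le] at hx
  have hd := hx (Ioo_subset_Icc_self hx') 0 ⟨le_rfl, (G.length_pos e).le⟩
  refine hd.unique ((hasDerivAt_const x (0 : 𝕜)).congr_of_eventuallyEq ?_)
  filter_upwards [isOpen_Ioo.mem_nhds hx'] with y hy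
  exact hint y (Ioo_subset_Icc_self hy)

/-- The operator associated with the form is single-valued. -/
theorem eq_zero_of_mem_laplacianGraph {𝔙 : Set (V ⊕ G.TopEnd)} (q : G.L2 𝕜 × G.L2 𝕜)
    (hq : q ∈ G.laplacianGraph 𝕜 𝔙) (h : q.1 = 0) : q.2 = 0 := by
  obtain ⟨p, hp, h1, h2⟩ := hq
  have hw : p.snd = 0 := snd_eq_zero_of_mem_H10 hp (h1.trans h)
  ext1
  funext e
  apply Lp.ext
  refine EventuallyEq.trans ?_ (Lp.coeFn_zero 𝕜 2 (G.edgeMeasure e)).symm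
  have hfin : IsFiniteMeasure (G.edgeMeasure e) := by unfold edgeMeasure; infer_instance
  have hi : Integrable (q.2 e) (G.edgeMeasure e) := (Lp.memLp (q.2 e)).integrable (by norm_num)
  have hloc : LocallyIntegrableOn (q.2 e) (Ioo 0 (G.length e)) volume :=
    IntegrableOn.locallyIntegrableOn hi
  refine (ae_restrict_iff' measurableSet_Ioo).2
    (isOpen_Ioo.ae_eq_zero_of_integral_contDiff_smul_eq_zero hloc fun g hg hgc hgs => ?_)
  obtain ⟨φ, hφ, u, hu, hin⟩ := exists_bump_mem_H10 (𝕜 := 𝕜) 𝔙 e g hg hgc hgs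
  have h3 := h2 φ hφ
  rw [hw, inner_zero_right, hin, L2.inner_def] at h3
  rw [← setIntegral_eq_integral_of_forall_compl_eq_zero (s := Ioo 0 (G.length e))
    fun x hx => by rw [image_eq_zero_of_notMem_tsupport fun hx' => hx (hgs hx'), zero_smul]]
  rw [h3]
  refine integral_congr_ae ?_
  filter_upwards [hu] with x hx
  rw [hx, RCLike.inner_apply, RCLike.conj_ofReal, RCLike.real_smul_eq_coe_mul, mul_comm]

variable (G 𝕜)

theorem laplacian_graph (𝔙 : Set (V ⊕ G.TopEnd)) :
    (G.laplacian 𝕜 𝔙).graph = G.laplacianGraph 𝕜 𝔙 :=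
  Submodule.toLinearPMap_graph_eq _ fun q hq h => eq_zero_of_mem_laplacianGraph q hq h

/-- The set of all ends and all leaves (vertices of degree one) of `G`. -/
def endsAndLeaves : Set (V ⊕ G.TopEnd) := Set.range Sum.inr ∪ Sum.inl '' {v | G.degree v = 1}

end MetricGraph

/-! ### Spectrum of unbounded operators -/

section Spectrum

variable {𝕜 H : Type*} [RCLike 𝕜] [NormedAddCommGroup H] [InnerProductSpace 𝕜 H]

/-- The resolvent set of an unbounded operator: the scalars `z` for which `T - z` has a bounded
everywhere defined inverse. -/
def pmapResolventSet (T : H →ₗ.[𝕜] H) : Set 𝕜 :=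
  {z | ∃ R : H →L[𝕜] H, (∀ y, ∃ h : R y ∈ T.domain, T ⟨R y, h⟩ - z • R y = y) ∧
    ∀ x : T.domain, R (T x - z • (x : H)) = x}

/-- The spectrum of an unbounded operator. -/
def pmapSpectrum (T : H →ₗ.[𝕜] H) : Set 𝕜 := (pmapResolventSet T)ᶜ

/-- The eigenspace `ker (T - z)`. -/
def pmapEigenspace (T : H →ₗ.[𝕜] H) (z : 𝕜) : Submodule 𝕜 T.domain :=
  LinearMap.ker (T.toFun - z • T.domain.subtype)

/-- The spectrum is purely discrete: it consists of isolated points that are eigenvalues of finite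
multiplicity. -/
def HasPurelyDiscreteSpectrum (T : H →ₗ.[𝕜] H) : Prop :=
  ∀ z ∈ pmapSpectrum T, (∀ᶠ z' in 𝓝[≠] z, z' ∉ pmapSpectrum T) ∧
    pmapEigenspace T z ≠ ⊥ ∧ FiniteDimensional 𝕜 (pmapEigenspace T z)

end Spectrum

end

section Spectral

variable {𝕜 H D : Type*} [RCLike 𝕜] [NormedAddCommGroup H] [InnerProductSpace 𝕜 H]

theorem isCompactOperator_of_finiteDimensional_approx [CompleteSpace H] [NormedAddCommGroup D]
    [NormedSpace 𝕜 D] (J : D →L[𝕜] H)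
    (h : ∀ η : ℝ, 0 < η → ∃ W : Submodule 𝕜 H, FiniteDimensional 𝕜 W ∧
      ∀ p, ∃ w ∈ W, ‖J p - w‖ ≤ η * ‖p‖) : IsCompactOperator J := by
  have hcl : IsClosed {f : D →L[𝕜] H | IsCompactOperator f} := isClosed_setOfPred_isCompactOperator
  have : J ∈ closure {f : D →L[𝕜] H | IsCompactOperator f} := by
    refine Metric.mem_closure_iff.2 fun η hη => ?_
    obtain ⟨W, hW, hJ⟩ := h (η / 2) (half_pos hη)
    refine ⟨W.starProjection ∘L J, ?_, ?_⟩
    · have hid : IsCompactOperator (id : W → W) :=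
        have := FiniteDimensional.proper 𝕜 W
        isCompactOperator_id
      exact (hid.comp_clm (W.orthogonalProjectionOnto ∘L J)).clm_comp W.subtypeL
    · rw [dist_eq_norm]
      refine (ContinuousLinearMap.opNorm_le_bound _ (half_pos hη).le fun p => ?_).trans_lt
        (half_lt_self hη)
      obtain ⟨w, hw, hp⟩ := hJ p
      refine le_trans ?_ hp
      change ‖J p - W.starProjection (J p)‖ ≤ _
      rw [Submodule.starProjection_minimal]
      exact ciInf_le ⟨0, by rintro _ ⟨x, rfl⟩; exact norm_nonneg _⟩ (⟨w, hw⟩ : W)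
  rwa [hcl.closure_eq] at this

/-- Nonzero eigenvalues of a compact symmetric operator are isolated points of the spectrum. -/
theorem eventually_mem_resolventSet_of_compact_symmetric [CompleteSpace H] {R : H →L[𝕜] H}
    (hR : IsCompactOperator R) (hsymm : (R : H →ₗ[𝕜] H).IsSymmetric) {l : 𝕜} (hl : l ≠ 0) :
    ∀ᶠ l' in 𝓝[≠] l, l' ∈ resolventSet 𝕜 R := by
  set F : Submodule 𝕜 H := Module.End.eigenspace (R : H →ₗ[𝕜] H) l with hF
  have hFfin : FiniteDimensional 𝕜 F := ContinuousLinearMap.finite_dimensional_eigenspace hR l hl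
  have hmem : ∀ x, x ∈ F ↔ R x = l • x := fun x => Module.End.mem_eigenspace_iff
  have horth : ∀ x ∈ Fᗮ, R x ∈ Fᗮ := by
    intro x hx y hy
    have h1 : ⟪R y, x⟫_𝕜 = ⟪y, R x⟫_𝕜 := hsymm y x
    rw [← h1, (hmem y).1 hy, inner_smul_left, hx y hy, mul_zero]
  set S : H →L[𝕜] H := R ∘L Fᗮ.starProjection with hS
  have hSc : IsCompactOperator S := hR.comp_clm _
  have hnot : ¬ Module.End.HasEigenvalue (S : Module.End 𝕜 H) l := by
    intro h
    obtain ⟨x, hx, hx0⟩ := h.exists_hasEigenvector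
    have hx' : S x = l • x := Module.End.mem_eigenspace_iff.1 hx
    have hxF : x ∈ Fᗮ := by
      have h1 : S x ∈ Fᗮ := horth _ (Submodule.starProjection_apply_mem _ _)
      rw [hx'] at h1
      simpa [smul_smul, inv_mul_cancel₀ hl] using Fᗮ.smul_mem l⁻¹ h1
    have hxS : S x = R x := by
      rw [hS, ContinuousLinearMap.comp_apply, Submodule.starProjection_eq_self_iff.2 hxF]
    have hxF' : x ∈ F := (hmem x).2 (hxS ▸ hx')
    exact hx0 (inner_self_eq_zero.1 (hxF x hxF'))
  have hres : l ∈ resolventSet 𝕜 S := (hSc.hasEigenvalue_or_mem_resolventSet hl).resolve_left hnot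
  have hev : ∀ᶠ l' in 𝓝 l, l' ∈ resolventSet 𝕜 S :=
    (spectrum.isOpen_resolventSet S).mem_nhds hres
  have hev0 : ∀ᶠ l' in 𝓝 l, l' ≠ 0 := isOpen_ne.mem_nhds hl
  filter_upwards [hev.filter_mono nhdsWithin_le_nhds, hev0.filter_mono nhdsWithin_le_nhds,
    self_mem_nhdsWithin] with l' h1 h2 h3
  refine (hR.hasEigenvalue_or_mem_resolventSet h2).resolve_left fun h => ?_
  obtain ⟨x, hx, hx0⟩ := h.exists_hasEigenvector
  have hx' : R x = l' • x := Module.End.mem_eigenspace_iff.1 hx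
  have hxF : x ∈ Fᗮ := by
    have := hsymm.orthogonalFamily_eigenspaces.pairwise (Ne.symm h3 : l ≠ l')
    intro y hy
    exact (Submodule.isOrtho_iff_inner_eq.1 this) y hy x hx
  have hSx : S x = l' • x := by
    rw [hS, ContinuousLinearMap.comp_apply, Submodule.starProjection_eq_self_iff.2 hxF, hx']
  have : Module.End.HasEigenvalue (S : Module.End 𝕜 H) l' :=
    Module.End.hasEigenvalue_of_hasEigenvector ⟨Module.End.mem_eigenspace_iff.2 hSx, hx0⟩
  exact ((hSc.hasEigenvalue_iff_mem_spectrum h2).1 this) h1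

/-- If `T = R⁻¹ - 1` with `R` compact and symmetric, then `T` has purely discrete spectrum. -/
theorem hasPurelyDiscreteSpectrum_of_graph_eq [CompleteSpace H] (T : H →ₗ.[𝕜] H) {R : H →L[𝕜] H}
    (hR : IsCompactOperator R) (hsymm : (R : H →ₗ[𝕜] H).IsSymmetric)
    (hT : ∀ x y, (x, y) ∈ T.graph ↔ x = R (x + y)) : HasPurelyDiscreteSpectrum T := by
  have hgr : ∀ x y, x = R (x + y) → ∃ h : x ∈ T.domain, T ⟨x, h⟩ = y := by
    intro x y h
    obtain ⟨z, hz1, hz2⟩ := (LinearPMap.mem_graph_iff T).1 ((hT x y).2 h)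
    subst hz1
    exact ⟨z.2, hz2⟩
  have hgr' : ∀ x : T.domain, (x : H) = R (x + T x) := fun x => (hT _ _).1 (T.mem_graph x)
  have hres0 : (-1 : 𝕜) ∈ pmapResolventSet T := by
    refine ⟨R, fun y => ?_, fun x => ?_⟩
    · obtain ⟨h, h'⟩ := hgr (R y) (y - R y) (by congr 1; abel)
      exact ⟨h, by rw [h']; module⟩
    · rw [show T x - (-1 : 𝕜) • (x : H) = x + T x by module]
      exact (hgr' x).symm
  have hres : ∀ z : 𝕜, z + 1 ≠ 0 → (z + 1)⁻¹ ∈ resolventSet 𝕜 R → z ∈ pmapResolventSet T := by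
    intro z hz h
    have hu : IsUnit (algebraMap 𝕜 (H →L[𝕜] H) (z + 1)⁻¹ - R) := h
    obtain ⟨B, hB⟩ := hu.exists_right_inv
    obtain ⟨B', hB'⟩ := hu.exists_left_inv
    have hBB : B' = B := left_inv_eq_right_inv hB' hB
    subst hBB
    have hB1 : ∀ y, (z + 1)⁻¹ • B' y - R (B' y) = y := fun y => by
      have := congrArg (fun A : H →L[𝕜] H => A y) hB
      simpa [Algebra.algebraMap_eq_smul_one] using this
    have hB2 : ∀ y, B' ((z + 1)⁻¹ • y - R y) = y := fun y => by
      have := congrArg (fun A : H →L[𝕜] H => A y) hB'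
      simpa [Algebra.algebraMap_eq_smul_one] using this
    have hsc : ∀ x : H, (z + 1) • (z + 1)⁻¹ • x = x := fun x => by
      rw [smul_smul, mul_inv_cancel₀ hz, one_smul]
    refine ⟨(z + 1)⁻¹ • (R ∘L B'), fun y => ?_, fun x => ?_⟩
    · set x := (z + 1)⁻¹ • R (B' y) with hx
      obtain ⟨h, h'⟩ := hgr x (y + z • x) (by
        have : x + (y + z • x) = (z + 1)⁻¹ • B' y := by
          rw [show x + (y + z • x) = y + (z + 1) • x by module, hx, hsc]
          nth_rewrite 1 [← hB1 y]
          abel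
        rw [this, map_smul])
      refine ⟨h, ?_⟩
      change T ⟨x, h⟩ - z • x = y
      rw [h']; abel
    · have h1 := hgr' x
      set w : H := x + T x with hw
      have h2 : T x - z • (x : H) = (z + 1) • ((z + 1)⁻¹ • w - R w) := by
        rw [smul_sub, hsc, ← h1, hw]; module
      change (z + 1)⁻¹ • R (B' (T x - z • (x : H))) = x
      rw [h2, map_smul, hB2, map_smul, ← h1, smul_smul, inv_mul_cancel₀ hz, one_smul]
  intro z hz
  have hz1 : z + 1 ≠ 0 := fun h => hz (by rwa [show z = -1 from eq_neg_of_add_eq_zero_left h])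
  have hev : ∀ᶠ z' in 𝓝[≠] z, (z' + 1)⁻¹ ∈ resolventSet 𝕜 R := by
    have hc : ContinuousAt (fun z' : 𝕜 => (z' + 1)⁻¹) z :=
      (continuousAt_id.add continuousAt_const).inv₀ hz1
    have ht : Tendsto (fun z' : 𝕜 => (z' + 1)⁻¹) (𝓝[≠] z) (𝓝[≠] (z + 1)⁻¹) := by
      refine tendsto_nhdsWithin_iff.2 ⟨hc.tendsto.mono_left nhdsWithin_le_nhds, ?_⟩
      filter_upwards [self_mem_nhdsWithin] with z' hz' h
      exact hz' (by simpa using h)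
    exact ht.eventually (eventually_mem_resolventSet_of_compact_symmetric hR hsymm
      (inv_ne_zero hz1))
  have hev1 : ∀ᶠ z' in 𝓝[≠] z, z' + 1 ≠ 0 :=
    Eventually.filter_mono nhdsWithin_le_nhds
      ((continuous_id.add continuous_const).continuousAt.eventually_ne hz1)
  have hinv : ∀ x : H, R x = (z + 1)⁻¹ • x ↔ x = R ((z + 1) • x) := fun x => by
    rw [map_smul]
    constructor
    · intro h; rw [h, smul_smul, mul_inv_cancel₀ hz1, one_smul]
    · intro h; nth_rewrite 2 [h]; rw [smul_smul, inv_mul_cancel₀ hz1, one_smul]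
  have hmem : ∀ x : T.domain, x ∈ pmapEigenspace T z ↔ T x = z • (x : H) := fun x => by
    change T x - z • (x : H) = 0 ↔ _
    exact sub_eq_zero
  refine ⟨?_, ?_, ?_⟩
  · filter_upwards [hev, hev1] with z' h1 h2 h3
    exact h3 (hres z' h2 h1)
  · have heig := (hR.hasEigenvalue_or_mem_resolventSet (inv_ne_zero hz1)).resolve_right
      fun h => hz (hres z hz1 h)
    obtain ⟨x, hx, hx0⟩ := heig.exists_hasEigenvector
    have hx' : R x = (z + 1)⁻¹ • x := Module.End.mem_eigenspace_iff.1 hx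
    obtain ⟨h, h'⟩ := hgr x (z • x) (by
      rw [show x + z • x = (z + 1) • x by module]; exact (hinv x).1 hx')
    intro hbot
    have : (⟨x, h⟩ : T.domain) ∈ pmapEigenspace T z := (hmem _).2 h'
    rw [hbot, Submodule.mem_bot] at this
    exact hx0 (congrArg Subtype.val this)
  · have hfin := ContinuousLinearMap.finite_dimensional_eigenspace hR _ (inv_ne_zero hz1)
    let i : pmapEigenspace T z →ₗ[𝕜] Module.End.eigenspace (R : H →ₗ[𝕜] H) (z + 1)⁻¹ :=
      (T.domain.subtype ∘ₗ (pmapEigenspace T z).subtype).codRestrict _ fun x => by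
        refine Module.End.mem_eigenspace_iff.2 ((hinv _).2 ?_)
        change ((x : T.domain) : H) = R ((z + 1) • ((x : T.domain) : H))
        have h1 := hgr' x.1
        rw [(hmem _).1 x.2] at h1
        rwa [show (z + 1) • ((x : T.domain) : H) = x + z • ((x : T.domain) : H) by module]
    refine FiniteDimensional.of_injective i fun x y hxy => ?_
    have h1 : (i x : H) = i y := congrArg _ hxy
    exact Subtype.ext (Subtype.ext h1)

/-- If `T = (J J*)⁻¹ - 1` with `J` compact, then `T` has purely discrete spectrum. -/
theorem hasPurelyDiscreteSpectrum_of_graph_eq_comp_adjoint [CompleteSpace H]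
    [NormedAddCommGroup D] [InnerProductSpace 𝕜 D] [CompleteSpace D] (T : H →ₗ.[𝕜] H)
    {J : D →L[𝕜] H} (hJ : IsCompactOperator J)
    (hT : ∀ x y, (x, y) ∈ T.graph ↔ x = (J ∘L J.adjoint) (x + y)) :
    HasPurelyDiscreteSpectrum T := by
  refine hasPurelyDiscreteSpectrum_of_graph_eq T (R := J ∘L J.adjoint) (hJ.comp_clm _)
    (fun x y => ?_) hT
  change ⟪J (J.adjoint x), y⟫_𝕜 = ⟪x, J (J.adjoint y)⟫_𝕜
  rw [← ContinuousLinearMap.adjoint_inner_right, ContinuousLinearMap.adjoint_inner_left]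

end Spectral

namespace SimpleGraph

theorem IsTree.eq_of_adj_of_dist_lt {V : Type*} {T : SimpleGraph V} (hT : T.IsTree) {r u u' v : V}
    (h : T.Adj u v) (h' : T.Adj u' v) (hd : T.dist r u < T.dist r v)
    (hd' : T.dist r u' < T.dist r v) : u = u' := by
  classical
  have key : ∀ w, T.Adj w v → T.dist r w < T.dist r v →
      ∃ p : T.Walk r v, p.IsPath ∧ p.penultimate = w := by
    intro w hw hlt
    obtain ⟨q, hq, hql⟩ := hT.connected.exists_path_of_dist r w
    have hv : v ∉ q.support := fun hv => by
      have h1 := T.dist_le (q.takeUntil v hv)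
      have h2 := q.length_takeUntil_le_length hv
      omega
    exact ⟨q.concat hw, hq.concat hv hw, by simp⟩
  obtain ⟨p, hp, hpu⟩ := key u h hd
  obtain ⟨p', hp', hpu'⟩ := key u' h' hd'
  rw [← hpu, ← hpu', (hT.existsUnique_path r v).unique hp hp']

theorem Connected.exists_adj_dist_lt {V : Type*} {T : SimpleGraph V} (hT : T.Connected) {r v : V}
    (hv : v ≠ r) : ∃ u, T.Adj u v ∧ T.dist r u < T.dist r v := by
  obtain ⟨p, hp⟩ := hT.exists_walk_length_eq_dist v r
  cases p with
  | nil => exact absurd rfl hv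
  | cons h q =>
    refine ⟨_, h.symm, ?_⟩
    rw [Walk.length_cons, T.dist_comm] at hp
    have := T.dist_le q.reverse
    rw [Walk.length_reverse] at this
    omega

end SimpleGraph

theorem ENNReal.tsum_ite_add_le {ι : Type*} {P Q : ι → Prop} [DecidablePred P] [DecidablePred Q]
    (w : ι → ℝ≥0∞) (hPQ : ∀ i, P i → Q i) {j : ι} (hP : ¬ P j) (hQ : Q j) :
    (∑' i, if P i then w i else 0) + w j ≤ ∑' i, if Q i then w i else 0 := by
  classical
  rw [← tsum_ite_eq j fun _ => w j, ← ENNReal.tsum_add]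
  refine ENNReal.tsum_le_tsum fun i => ?_
  by_cases hi : i = j
  · subst hi; simp [hP, hQ]
  · by_cases h : P i
    · simp [hi, h, hPQ i h]
    · simp [hi, h]

namespace MetricGraph

variable {V E : Type*} {G : MetricGraph V E}

open Classical in
theorem segmentLength_eq (s : G.Segment) : G.segmentLength s =
    ∑' e, if Quot.mk G.JoinedAtDummy e = s then ENNReal.ofReal (G.length e) else 0 := by
  rw [segmentLength]
  have := tsum_subtype {e | Quot.mk G.JoinedAtDummy e = s} fun e => ENNReal.ofReal (G.length e)
  refine Eq.trans this (tsum_congr fun e => ?_)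
  simp [indicator_apply]

theorem exists_length_le (hlength : ∀ s, G.segmentLength s < ⊤)
    (hsmall : ∀ ε : ℝ, 0 < ε → {s | ENNReal.ofReal ε < G.segmentLength s}.Finite) :
    ∃ L : ℝ, 0 < L ∧ ∀ e, G.length e ≤ L := by
  classical
  set F := (hsmall 1 one_pos).toFinset
  have hsum : 0 ≤ ∑ s ∈ F, (G.segmentLength s).toReal :=
    Finset.sum_nonneg fun _ _ => ENNReal.toReal_nonneg
  refine ⟨1 + ∑ s ∈ F, (G.segmentLength s).toReal, by linarith, fun e => ?_⟩
  set s : G.Segment := Quot.mk G.JoinedAtDummy e with hs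
  have hle : ENNReal.ofReal (G.length e) ≤ G.segmentLength s :=
    ENNReal.le_tsum (f := fun e : {e : E // Quot.mk G.JoinedAtDummy e = s} =>
      ENNReal.ofReal (G.length e)) ⟨e, rfl⟩
  by_cases h : ENNReal.ofReal 1 < G.segmentLength s
  · have h1 : G.length e ≤ (G.segmentLength s).toReal :=
      (ENNReal.ofReal_le_iff_le_toReal (hlength s).ne).1 hle
    have h2 : (G.segmentLength s).toReal ≤ _ := Finset.single_le_sum (s := F) (f := fun s => (G.segmentLength s).toReal)
      (fun _ _ => ENNReal.toReal_nonneg) (by simpa [F] using h : s ∈ F)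
    linarith
  · have h1 := (ENNReal.ofReal_le_ofReal_iff zero_le_one).1 (hle.trans (not_lt.1 h))
    linarith

/-- An orientation of the edges of a tree away from a root. -/
structure Rooting (G : MetricGraph V E) where
  root : V
  head : E → Bool
  depth : V → ℕ
  depth_head : ∀ e, depth (G.endpoint e (head e)) = depth (G.endpoint e (!head e)) + 1
  head_injective : Function.Injective fun e => G.endpoint e (head e)
  exists_head : ∀ v, v ≠ root → ∃ e, G.endpoint e (head e) = v

theorem adjacency_adj_iff {v w : V} : G.adjacency.Adj v w ↔
    v ≠ w ∧ ∃ e b, G.endpoint e b = v ∧ G.endpoint e (!b) = w := by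
  rw [adjacency, SimpleGraph.fromRel_adj]
  refine and_congr_right fun _ => ⟨?_, ?_⟩
  · rintro (⟨e, h1, h2⟩ | ⟨e, h1, h2⟩)
    · exact ⟨e, false, h1, h2⟩
    · exact ⟨e, true, h2, h1⟩
  · rintro ⟨e, b, h1, h2⟩
    cases b
    · exact Or.inl ⟨e, h1, h2⟩
    · exact Or.inr ⟨e, h2, h1⟩

theorem IsTree.exists_rooting (h : G.IsTree) : Nonempty G.Rooting := by
  obtain ⟨r⟩ := h.isTree.connected.nonempty
  have hloop : ∀ e b, G.endpoint e b ≠ G.endpoint e (!b) := fun e b => by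
    cases b
    · exact h.no_loops e
    · exact (h.no_loops e).symm
  have hpar : ∀ e e' b b', G.endpoint e b = G.endpoint e' b' →
      G.endpoint e (!b) = G.endpoint e' (!b') → e = e' := fun e e' b b' h1 h2 => by
    refine h.no_parallel e e' (Sym2.eq_iff.2 ?_)
    cases b <;> cases b' <;> simp_all
  have hadj : ∀ e b, G.adjacency.Adj (G.endpoint e b) (G.endpoint e (!b)) := fun e b =>
    adjacency_adj_iff.2 ⟨hloop e b, e, b, rfl, rfl⟩
  have hb : ∀ e, ∃ b, G.adjacency.dist r (G.endpoint e b) =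
      G.adjacency.dist r (G.endpoint e (!b)) + 1 := fun e => by
    rcases h.isTree.dist_eq_dist_add_one_of_adj r (hadj e true) with h1 | h1
    · exact ⟨true, h1⟩
    · exact ⟨false, h1⟩
  choose b hb using hb
  refine ⟨⟨r, b, G.adjacency.dist r, hb, fun e e' hee => ?_, fun v hv => ?_⟩⟩
  · have hee : G.endpoint e (b e) = G.endpoint e' (b e') := hee
    refine hpar e e' (b e) (b e') hee ?_
    refine h.isTree.eq_of_adj_of_dist_lt (r := r) (hadj e (b e)).symm ?_ ?_ ?_
    · rw [hee]; exact (hadj e' (b e')).symm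
    · rw [hb]; exact Nat.lt_succ_self _
    · rw [hee, hb]; exact Nat.lt_succ_self _
  · obtain ⟨u, hu, hlt⟩ := h.isTree.connected.exists_adj_dist_lt hv
    obtain ⟨-, e, b', h1, h2⟩ := adjacency_adj_iff.1 hu
    refine ⟨e, ?_⟩
    rcases Bool.eq_or_eq_not b' (b e) with hbb | hbb
    · have := hb e
      rw [← hbb, h1, h2] at this
      omega
    · rw [← h2, hbb, Bool.not_not]

namespace Rooting

variable (R : G.Rooting)

/-- The vertex of `e` farther away from the root. -/
def dst (e : E) : V := G.endpoint e (R.head e)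

/-- The vertex of `e` closer to the root. -/
def src (e : E) : V := G.endpoint e (!R.head e)

theorem depth_dst (e : E) : R.depth (R.dst e) = R.depth (R.src e) + 1 := R.depth_head e

theorem dst_injective : Function.Injective R.dst := R.head_injective

theorem eq_root_or_exists_dst (v : V) : v = R.root ∨ ∃ e, R.dst e = v := by
  by_cases h : v = R.root
  · exact Or.inl h
  · exact Or.inr (R.exists_head v h)

theorem endpoint_eq (e : E) (b : Bool) : G.endpoint e b = R.dst e ∧ b = R.head e ∨
    G.endpoint e b = R.src e ∧ b = !R.head e := by
  rcases Bool.eq_or_eq_not b (R.head e) with h | h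
  · exact Or.inl ⟨by rw [h]; rfl, h⟩
  · exact Or.inr ⟨by rw [h]; rfl, h⟩

theorem finite_edges_of_finite (hfin : G.LocallyFinite) {W : Set V} (hW : W.Finite) :
    {e | R.src e ∈ W ∨ R.dst e ∈ W}.Finite := by
  refine (hW.biUnion fun v _ => (hfin v).image Prod.fst).subset ?_
  rintro e (h | h)
  · exact mem_biUnion h ⟨(e, !R.head e), rfl, rfl⟩
  · exact mem_biUnion h ⟨(e, R.head e), rfl, rfl⟩

theorem finite_depth_le (hfin : G.LocallyFinite) (n : ℕ) : {v | R.depth v ≤ n}.Finite := by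
  induction n with
  | zero =>
    refine (finite_singleton R.root).subset fun v (hv : R.depth v ≤ 0) => ?_
    rcases R.eq_root_or_exists_dst v with h | ⟨e, rfl⟩
    · exact h
    · rw [R.depth_dst] at hv; omega
  | succ n ih =>
    refine ((finite_singleton R.root).union
      ((R.finite_edges_of_finite hfin ih).image R.dst)).subset
      fun v (hv : R.depth v ≤ n + 1) => ?_
    rcases R.eq_root_or_exists_dst v with h | ⟨e, rfl⟩
    · exact Or.inl h
    · refine Or.inr ⟨e, Or.inl ?_, rfl⟩
      rw [R.depth_dst] at hv
      exact Nat.le_of_succ_le_succ hv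

theorem finite_edges_depth_le (hfin : G.LocallyFinite) (n : ℕ) :
    {e | R.depth (R.dst e) ≤ n}.Finite :=
  (R.finite_depth_le hfin n).preimage R.dst_injective.injOn

theorem degree_dst (e : E) : G.degree (R.dst e) = 1 ∨
    (G.degree (R.dst e) = 2 ∧ ∃ c, R.src c = R.dst e) ∨
    ∃ c c', c ≠ c' ∧ R.src c = R.dst e ∧ R.src c' = R.dst e := by
  have hmem : (e, R.head e) ∈ G.edgeEnds (R.dst e) := rfl
  have hchild : ∀ p ∈ G.edgeEnds (R.dst e) \ {(e, R.head e)},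
      R.src p.1 = R.dst e ∧ p.2 = !R.head p.1 := by
    rintro ⟨c, b⟩ ⟨h1, h2⟩
    have h1 : G.endpoint c b = R.dst e := h1
    rcases R.endpoint_eq c b with ⟨h3, h4⟩ | ⟨h3, h4⟩
    · have : c = e := R.dst_injective (h3 ▸ h1)
      subst this
      exact absurd (by rw [h4]; rfl) h2
    · exact ⟨h3 ▸ h1, h4⟩
  have hcard := encard_sdiff_singleton_add_one hmem
  rcases (G.edgeEnds (R.dst e) \ {(e, R.head e)}).eq_empty_or_nonempty with h0 | ⟨p, hp⟩
  · left
    rw [degree, ← hcard, h0, encard_empty, zero_add]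
  · right
    by_cases h : ∃ q ∈ G.edgeEnds (R.dst e) \ {(e, R.head e)}, q ≠ p
    · right
      obtain ⟨q, hq, hqp⟩ := h
      obtain ⟨h1, h2⟩ := hchild p hp
      obtain ⟨h3, h4⟩ := hchild q hq
      exact ⟨p.1, q.1, fun h => hqp (Prod.ext h.symm (by rw [h2, h4, h])), h1, h3⟩
    · left
      push Not at h
      have h1 : G.edgeEnds (R.dst e) \ {(e, R.head e)} = {p} :=
        Set.eq_singleton_iff_unique_mem.2 ⟨hp, h⟩
      refine ⟨?_, p.1, (hchild p hp).1⟩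
      rw [degree, ← hcard, h1, encard_singleton]
      norm_num

open Classical in
/-- The part of the segment `s` consisting of edges below depth `N` has length at most `ε`. -/
def TailsLE (N : ℕ) (ε : ℝ) : Prop := ∀ s : G.Segment,
  (∑' e, if Quot.mk G.JoinedAtDummy e = s ∧ N < R.depth (R.dst e) then
    ENNReal.ofReal (G.length e) else 0) ≤ ENNReal.ofReal ε

theorem exists_tailsLE (hlength : ∀ s, G.segmentLength s < ⊤)
    (hsmall : ∀ ε : ℝ, 0 < ε → {s | ENNReal.ofReal ε < G.segmentLength s}.Finite) {ε : ℝ}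
    (hε : 0 < ε) : ∃ N, R.TailsLE N ε := by
  classical
  have hN : ∀ s : G.Segment, ∃ N, ∀ n, N ≤ n →
      (∑' e, if Quot.mk G.JoinedAtDummy e = s ∧ n < R.depth (R.dst e) then
        ENNReal.ofReal (G.length e) else 0) ≤ ENNReal.ofReal ε := by
    intro s
    have hs := (hlength s).ne
    rw [segmentLength_eq] at hs
    have ht := ENNReal.tendsto_tsum_compl_atTop_zero hs
    obtain ⟨F, hF⟩ := (ht.eventually (gt_mem_nhds (ENNReal.ofReal_pos.2 hε))).exists
    refine ⟨F.sup fun e => R.depth (R.dst e), fun n hn => le_trans ?_ hF.le⟩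
    have := tsum_subtype {e | e ∉ F} fun e =>
      if Quot.mk G.JoinedAtDummy e = s then ENNReal.ofReal (G.length e) else 0
    refine le_trans (ENNReal.tsum_le_tsum fun e => ?_) this.ge
    split_ifs with h
    · have : e ∉ F := fun heF => by
        have h1 : R.depth (R.dst e) ≤ _ := Finset.le_sup (f := fun e => R.depth (R.dst e)) heF
        have h2 := h.2
        omega
      rw [indicator_of_mem (show e ∈ {e | e ∉ F} from this), if_pos h.1]
    · exact zero_le
  choose N hN using hN
  refine ⟨(hsmall ε hε).toFinset.sup N, fun s => ?_⟩
  by_cases hs : ENNReal.ofReal ε < G.segmentLength s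
  · exact hN s _ (Finset.le_sup (by simpa using hs))
  · refine le_trans ?_ (not_lt.1 hs)
    rw [segmentLength_eq]
    refine ENNReal.tsum_le_tsum fun e => ?_
    split_ifs with h1 h2 h2
    · exact le_rfl
    · exact absurd h1.1 h2
    · exact zero_le
    · exact le_rfl

theorem quot_mk_eq_of_degree_two {e c : E} (h : R.src c = R.dst e) (hd : G.degree (R.dst e) = 2) :
    Quot.mk G.JoinedAtDummy e = Quot.mk G.JoinedAtDummy c :=
  Quot.sound ⟨R.dst e, _, _, hd, rfl, h⟩

/-- A weight on the edges that grows at unit speed along the segments and starts again at `0` where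
a segment begins; on a segment with small tails, it is small. -/
theorem exists_offset {N : ℕ} {ε : ℝ} (hε : 0 ≤ ε) (hseg : R.TailsLE N ε) :
    ∃ a : E → ℝ, (∀ e, 0 ≤ a e) ∧ (∀ e, N < R.depth (R.dst e) → a e + G.length e ≤ ε) ∧
      ∀ e c, N < R.depth (R.dst e) → R.src c = R.dst e → G.degree (R.dst e) = 2 →
        a e + G.length e ≤ a c := by
  classical
  set w : E → ℝ≥0∞ := fun e => ENNReal.ofReal (G.length e) with hw
  set P : E → E → Prop := fun c e => Quot.mk G.JoinedAtDummy e = Quot.mk G.JoinedAtDummy c ∧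
    N < R.depth (R.dst e) ∧ R.depth (R.dst e) < R.depth (R.dst c) with hP
  have hself : ∀ e, ¬ P e e := fun e h => lt_irrefl _ h.2.2
  set A : E → ℝ≥0∞ := fun c => ∑' e, if P c e then w e else 0 with hA
  have hle : ∀ c, A c ≤ ENNReal.ofReal ε := fun c => by
    refine le_trans (ENNReal.tsum_le_tsum fun e => ?_) (hseg (Quot.mk _ c))
    by_cases h : P c e
    · rw [if_pos h, if_pos ⟨h.1, h.2.1⟩]
    · rw [if_neg h]; exact zero_le
  have htop : ∀ c, A c ≠ ⊤ := fun c => ((hle c).trans_lt ENNReal.ofReal_lt_top).ne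
  have hreal : ∀ e, (A e + w e).toReal = (A e).toReal + G.length e := fun e => by
    rw [ENNReal.toReal_add (htop e) ENNReal.ofReal_ne_top,
      ENNReal.toReal_ofReal (G.length_pos e).le]
  refine ⟨fun c => (A c).toReal, fun e => ENNReal.toReal_nonneg, fun e he => ?_,
    fun e c he hc hd => ?_⟩
  · rw [← hreal]
    refine ENNReal.toReal_le_of_le_ofReal hε (le_trans ?_ (hseg (Quot.mk _ e)))
    exact ENNReal.tsum_ite_add_le w (fun i hi => ⟨hi.1, hi.2.1⟩) (hself e) ⟨rfl, he⟩
  · rw [← hreal]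
    refine ENNReal.toReal_mono (htop c) ?_
    have hq := R.quot_mk_eq_of_degree_two hc hd
    have hlt : R.depth (R.dst e) < R.depth (R.dst c) := by
      rw [R.depth_dst c, hc]; exact Nat.lt_succ_self _
    exact ENNReal.tsum_ite_add_le w (fun i hi => ⟨hi.1.trans hq, hi.2.1, hi.2.2.trans hlt⟩)
      (hself e) ⟨hq, he, hlt⟩

/-- The discrete Poincaré inequality for functions of finite support. -/
theorem sum_length_mul_le_of_finite (hfin : G.LocallyFinite) {N : ℕ} {ε : ℝ} (hε : 0 ≤ ε)
    (hseg : R.TailsLE N ε) {u : V → ℝ} (hu0 : ∀ v, 0 ≤ u v)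
    (hleaf : ∀ v, G.degree v = 1 → u v = 0) (hu : {v | u v ≠ 0}.Finite) {K : E → ℝ}
    (hK0 : ∀ e, 0 ≤ K e) (hK : ∀ e, u (R.src e) ≤ u (R.dst e) + K e) {C : ℝ}
    (hKC : ∀ S : Finset E, ∑ e ∈ S, K e ≤ C) (S' : Finset E)
    (hS' : ∀ e ∈ S', N < R.depth (R.dst e)) :
    ∑ e ∈ S', G.length e * u (R.dst e) ≤ 2 * ε * C := by
  classical
  obtain ⟨a, ha0, ha1, ha2⟩ := R.exists_offset hε hseg
  set S : Finset E := S' ∪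
    (R.finite_edges_of_finite hfin hu).toFinset.filter fun e => N < R.depth (R.dst e) with hS
  have hSN : ∀ e ∈ S, N < R.depth (R.dst e) := fun e he => by
    rcases Finset.mem_union.1 he with h | h
    · exact hS' e h
    · exact (Finset.mem_filter.1 h).2
  have hchild : ∀ e ∈ S, ∀ c, R.src c = R.dst e → u (R.dst e) ≠ 0 → c ∈ S := by
    intro e he c hc hne
    refine Finset.mem_union_right _ (Finset.mem_filter.2 ⟨?_, ?_⟩)
    · simp only [Finite.mem_toFinset]
      exact Or.inl (by rw [hc]; exact hne)
    · rw [R.depth_dst, hc]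
      exact (hSN e he).trans (Nat.lt_succ_self _)
  set g : E → ℝ := fun c => (ε + a c) * u (R.src c) with hg
  have hg0 : ∀ c, 0 ≤ g c := fun c => mul_nonneg (add_nonneg hε (ha0 c)) (hu0 _)
  have hlocal : ∀ e ∈ S, (ε + a e + G.length e) * u (R.dst e) ≤
      ∑ c ∈ S with R.src c = R.dst e, g c := by
    intro e he
    by_cases hne : u (R.dst e) = 0
    · rw [hne, mul_zero]; exact Finset.sum_nonneg fun c _ => hg0 c
    have hmem : ∀ c, R.src c = R.dst e → c ∈ S.filter fun c => R.src c = R.dst e :=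
      fun c hc => Finset.mem_filter.2 ⟨hchild e he c hc hne, hc⟩
    rcases R.degree_dst e with h | ⟨h, c, hc⟩ | ⟨c, c', hcc, hc, hc'⟩
    · exact absurd (hleaf _ h) hne
    · refine le_trans ?_ (Finset.single_le_sum (f := g) (fun c _ => hg0 c) (hmem c hc))
      simp only [hg]
      rw [hc]
      have := ha2 e c (hSN e he) hc h
      exact mul_le_mul_of_nonneg_right (by linarith) (hu0 _)
    · have hsub : ({c, c'} : Finset E) ⊆ S.filter fun c => R.src c = R.dst e := by
        intro x hx
        rcases Finset.mem_insert.1 hx with rfl | hx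
        · exact hmem _ hc
        · rw [Finset.mem_singleton.1 hx]; exact hmem _ hc'
      refine le_trans ?_ (Finset.sum_le_sum_of_subset_of_nonneg hsub fun c _ _ => hg0 c)
      rw [Finset.sum_pair hcc]
      simp only [hg]
      rw [hc, hc', ← add_mul]
      have := ha1 e (hSN e he)
      exact mul_le_mul_of_nonneg_right (by linarith [ha0 c, ha0 c']) (hu0 _)
  have hsum : ∑ e ∈ S, (ε + a e + G.length e) * u (R.dst e) ≤ ∑ c ∈ S, g c := by
    refine (Finset.sum_le_sum hlocal).trans ?_
    rw [← Finset.sum_biUnion]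
    · refine Finset.sum_le_sum_of_subset_of_nonneg (fun x hx => ?_) fun c _ _ => hg0 c
      obtain ⟨e, -, he⟩ := Finset.mem_biUnion.1 hx
      exact (Finset.mem_filter.1 he).1
    · intro e _ e' _ hne
      refine Finset.disjoint_left.2 fun c hc hc' => hne (R.dst_injective ?_)
      rw [← (Finset.mem_filter.1 hc).2, (Finset.mem_filter.1 hc').2]
  have hbound : ∀ e ∈ S, G.length e * u (R.dst e) ≤
      (ε + a e + G.length e) * u (R.dst e) - g e + 2 * ε * K e := by
    intro e he
    have h1 := mul_le_mul_of_nonneg_left (hK e) (add_nonneg hε (ha0 e))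
    have h2 : (ε + a e) * K e ≤ 2 * ε * K e :=
      mul_le_mul_of_nonneg_right (by linarith [ha1 e (hSN e he), G.length_pos e]) (hK0 e)
    simp only [hg]
    linarith
  calc ∑ e ∈ S', G.length e * u (R.dst e)
      ≤ ∑ e ∈ S, G.length e * u (R.dst e) :=
        Finset.sum_le_sum_of_subset_of_nonneg Finset.subset_union_left
          fun e _ _ => mul_nonneg (G.length_pos e).le (hu0 _)
    _ ≤ ∑ e ∈ S, ((ε + a e + G.length e) * u (R.dst e) - g e + 2 * ε * K e) :=
        Finset.sum_le_sum hbound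
    _ ≤ 2 * ε * C := by
        rw [Finset.sum_add_distrib, Finset.sum_sub_distrib, ← Finset.mul_sum]
        have := mul_le_mul_of_nonneg_left (hKC S) (by linarith : 0 ≤ 2 * ε)
        linarith

/-- The discrete Poincaré inequality for functions that vanish at infinity. -/
theorem sum_length_mul_le (hfin : G.LocallyFinite) {N : ℕ} {ε : ℝ} (hε : 0 ≤ ε)
    (hseg : R.TailsLE N ε) {U : V → ℝ}
    (hleaf : ∀ v, G.degree v = 1 → U v = 0) (hU : ∀ δ, 0 < δ → {e | δ ≤ U (R.dst e)}.Finite)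
    {K : E → ℝ} (hK0 : ∀ e, 0 ≤ K e) (hK : ∀ e, U (R.src e) ≤ U (R.dst e) + K e) {C : ℝ}
    (hKC : ∀ S : Finset E, ∑ e ∈ S, K e ≤ C) (S' : Finset E)
    (hS' : ∀ e ∈ S', N < R.depth (R.dst e)) :
    ∑ e ∈ S', G.length e * U (R.dst e) ≤ 2 * ε * C := by
  have hδ : ∀ δ, 0 < δ →
      ∑ e ∈ S', G.length e * U (R.dst e) ≤ 2 * ε * C + δ * ∑ e ∈ S', G.length e := by
    intro δ hδ
    have h := R.sum_length_mul_le_of_finite hfin hε hseg (u := fun v => max (U v - δ) 0)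
      (fun v => le_max_right _ _) (fun v hv => by rw [hleaf v hv]; exact max_eq_right (by linarith))
      (by
        refine ((finite_singleton R.root).union ((hU δ hδ).image R.dst)).subset fun v hv => ?_
        have hv : max (U v - δ) 0 ≠ 0 := hv
        have hvδ : δ ≤ U v := by
          by_contra hlt
          exact hv (max_eq_right (by linarith))
        rcases R.eq_root_or_exists_dst v with h | ⟨e, rfl⟩
        · exact Or.inl h
        · exact Or.inr ⟨e, hvδ, rfl⟩) hK0
      (fun e => by
        have h1 := hK e
        have h2 := hK0 e
        refine max_le ?_ ?_
        · linarith [le_max_left (U (R.dst e) - δ) 0]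
        · linarith [le_max_right (U (R.dst e) - δ) 0]) hKC S' hS'
    have h2 : ∑ e ∈ S', G.length e * U (R.dst e) ≤
        ∑ e ∈ S', (G.length e * max (U (R.dst e) - δ) 0 + δ * G.length e) := by
      refine Finset.sum_le_sum fun e _ => ?_
      have := mul_le_mul_of_nonneg_left (le_max_left (U (R.dst e) - δ) 0) (G.length_pos e).le
      linarith
    rw [Finset.sum_add_distrib, ← Finset.mul_sum] at h2
    linarith
  have hlim : Tendsto (fun δ : ℝ => 2 * ε * C + δ * ∑ e ∈ S', G.length e) (𝓝[>] 0)
      (𝓝 (2 * ε * C + 0 * ∑ e ∈ S', G.length e)) :=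
    ((continuous_const.add (continuous_id.mul continuous_const)).tendsto 0).mono_left
      nhdsWithin_le_nhds
  rw [zero_mul, add_zero] at hlim
  refine ge_of_tendsto hlim ?_
  filter_upwards [self_mem_nhdsWithin] with δ h
  exact hδ δ h

end Rooting

end MetricGraph

namespace MetricGraph

variable {V E : Type*} {G : MetricGraph V E} {𝕜 : Type*} [RCLike 𝕜]

variable (G) in
/-- The point of `G` given by a vertex. -/
noncomputable def vertexPt (v : V) : G.Point :=
  G.pt (G.exists_endpoint v).choose (G.endCoord _ (G.exists_endpoint v).choose_spec.choose)

theorem pt_endCoord (e : E) (b : Bool) : G.pt e (G.endCoord e b) = G.vertexPt (G.endpoint e b) :=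
  Quot.sound ⟨_, _, _, _, rfl, rfl, (G.exists_endpoint (G.endpoint e b)).choose_spec.choose_spec.symm⟩

theorem exists_edgeMap_eq_vertexPt (e : E) (b : Bool) :
    ∃ x ∈ Icc 0 (G.length e), G.edgeMap e x = G.vertexPt (G.endpoint e b) :=
  ⟨G.endCoord e b, (G.endCoord e b).2, by rw [← pt_endCoord, edgeMap, projIcc_val]⟩

theorem exists_edgeMap_eq (q : G.Point) : ∃ e, ∃ x ∈ Icc 0 (G.length e), G.edgeMap e x = q := by
  induction q using Quot.ind with
  | mk q => exact ⟨q.1, q.2, q.2.2, by rw [edgeMap, projIcc_val]; rfl⟩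

instance (e : E) : IsFiniteMeasure (G.edgeMeasure e) := by unfold edgeMeasure; infer_instance

theorem edgeMeasure_univ (e : E) : G.edgeMeasure e univ = ENNReal.ofReal (G.length e) := by
  rw [edgeMeasure, Measure.restrict_apply_univ, Real.volume_Ioo, sub_zero]

theorem measureUnivNNReal_edgeMeasure_rpow (e : E) :
    (measureUnivNNReal (G.edgeMeasure e) : ℝ) ^ (2 : ℝ≥0∞).toReal⁻¹ = √(G.length e) := by
  rw [Real.sqrt_eq_rpow]
  congr 1
  · rw [measureUnivNNReal, edgeMeasure_univ]
    exact ENNReal.toReal_ofReal (G.length_pos e).le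
  · norm_num

theorem norm_le_sqrt_length_mul {e : E} (u : Lp 𝕜 2 (G.edgeMeasure e)) {M : ℝ} (hM : 0 ≤ M)
    (h : ∀ᵐ x ∂(G.edgeMeasure e), ‖u x‖ ≤ M) : ‖u‖ ≤ √(G.length e) * M := by
  have := Lp.norm_le_of_ae_bound hM h
  rwa [measureUnivNNReal_edgeMeasure_rpow] at this

theorem norm_const_edge (e : E) (c : 𝕜) :
    ‖Lp.const 2 (G.edgeMeasure e) c‖ = ‖c‖ * √(G.length e) := by
  rw [Lp.norm_const' 2 (G.edgeMeasure e) c (by norm_num) (by norm_num), Measure.real,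
    edgeMeasure_univ, ENNReal.toReal_ofReal (G.length_pos e).le, Real.sqrt_eq_rpow]
  norm_num

theorem ae_mem_Ioo (e : E) : ∀ᵐ x ∂(G.edgeMeasure e), x ∈ Ioo 0 (G.length e) :=
  ae_restrict_mem measurableSet_Ioo

theorem norm_integral_le {e : E} (w : Lp 𝕜 2 (G.edgeMeasure e)) {x y : ℝ} (hx : 0 ≤ x)
    (hxy : x ≤ y) (hy : y ≤ G.length e) : ‖∫ t in x..y, w t‖ ≤ √(y - x) * ‖w‖ := by
  have hsub : Ioo x y ⊆ Ioo 0 (G.length e) := Ioo_subset_Ioo hx hy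
  have hμ : G.edgeMeasure e (Ioo x y) = ENNReal.ofReal (y - x) := by
    rw [edgeMeasure, Measure.restrict_apply measurableSet_Ioo, inter_eq_left.2 hsub,
      Real.volume_Ioo]
  have hr : (G.edgeMeasure e).restrict (Ioo x y) = volume.restrict (Ioo x y) := by
    rw [edgeMeasure, Measure.restrict_restrict measurableSet_Ioo, inter_eq_left.2 hsub]
  have h := L2.inner_indicatorConstLp_one (𝕜 := 𝕜) (μ := G.edgeMeasure e) (s := Ioo x y)
    measurableSet_Ioo (measure_ne_top _ _) w
  rw [hr] at h
  rw [intervalIntegral.integral_of_le hxy, integral_Ioc_eq_integral_Ioo]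
  refine (congrArg norm h).symm.le.trans ((norm_inner_le_norm _ _).trans (le_of_eq ?_))
  congr 1
  refine (norm_indicatorConstLp (by norm_num) (by norm_num)).trans ?_
  rw [norm_one, one_mul]
  change (G.edgeMeasure e (Ioo x y)).toReal ^ _ = _
  rw [hμ, ENNReal.toReal_ofReal (sub_nonneg.2 hxy), Real.sqrt_eq_rpow]
  norm_num

namespace IsSobolev

variable {f : G.Point → 𝕜} {p : G.L2Pair 𝕜}

theorem norm_sub_le_sqrt (hf : G.IsSobolev f p) (e : E) {x y : ℝ} (hx : x ∈ Icc 0 (G.length e))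
    (hy : y ∈ Icc 0 (G.length e)) (hxy : x ≤ y) :
    ‖f (G.edgeMap e y) - f (G.edgeMap e x)‖ ≤ √(y - x) * ‖p.snd e‖ := by
  rw [hf.eq_integral e x hx, hf.eq_integral e y hy, add_sub_add_left_eq_sub,
    intervalIntegral.integral_interval_sub_left (intervalIntegrable_coe _ hy)
      (intervalIntegrable_coe _ hx)]
  exact norm_integral_le _ hx.1 hxy hy.2

theorem norm_sub_le (hf : G.IsSobolev f p) (e : E) {x y : ℝ} (hx : x ∈ Icc 0 (G.length e))
    (hy : y ∈ Icc 0 (G.length e)) :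
    ‖f (G.edgeMap e x) - f (G.edgeMap e y)‖ ≤ √(G.length e) * ‖p.snd e‖ := by
  rcases le_total x y with h | h
  · rw [norm_sub_rev]
    exact (hf.norm_sub_le_sqrt e hx hy h).trans (mul_le_mul_of_nonneg_right
      (Real.sqrt_le_sqrt (by linarith [hx.1, hy.2])) (norm_nonneg _))
  · exact (hf.norm_sub_le_sqrt e hy hx h).trans (mul_le_mul_of_nonneg_right
      (Real.sqrt_le_sqrt (by linarith [hy.1, hx.2])) (norm_nonneg _))

theorem norm_mul_sqrt_le (hf : G.IsSobolev f p) (e : E) {x : ℝ} (hx : x ∈ Icc 0 (G.length e)) :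
    ‖f (G.edgeMap e x)‖ * √(G.length e) ≤ ‖p.fst e‖ + G.length e * ‖p.snd e‖ := by
  set c := f (G.edgeMap e x) with hc
  have h : ‖Lp.const 2 (G.edgeMeasure e) c - p.fst e‖ ≤
      √(G.length e) * (√(G.length e) * ‖p.snd e‖) := by
    refine norm_le_sqrt_length_mul _ (by positivity) ?_
    filter_upwards [Lp.coeFn_sub (Lp.const 2 (G.edgeMeasure e) c) (p.fst e),
      Lp.coeFn_const 2 (G.edgeMeasure e) c, hf.ae_eq e, ae_mem_Ioo e] with y h1 h2 h3 h4
    rw [h1, Pi.sub_apply, h2, h3]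
    exact hf.norm_sub_le e hx (Ioo_subset_Icc_self h4)
  rw [← mul_assoc, Real.mul_self_sqrt (G.length_pos e).le] at h
  rw [← norm_const_edge]
  have := norm_sub_norm_le (Lp.const 2 (G.edgeMeasure e) c) (p.fst e)
  linarith

end IsSobolev

/-- A bound for the oscillation of `|f|²` on the edge `e`. -/
noncomputable def oscBound (p : G.L2Pair 𝕜) (e : E) : ℝ :=
  2 * (‖p.fst e‖ + G.length e * ‖p.snd e‖) * ‖p.snd e‖

theorem oscBound_nonneg (p : G.L2Pair 𝕜) (e : E) : 0 ≤ oscBound p e := by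
  have := (G.length_pos e).le
  unfold oscBound
  positivity

theorem sum_norm_sq_le (u : G.L2 𝕜) (S : Finset E) : ∑ e ∈ S, ‖u e‖ ^ 2 ≤ ‖u‖ ^ 2 := by
  simpa using lp.sum_rpow_le_norm_rpow (p := 2) (by norm_num) u S

theorem norm_sq_eq (p : G.L2Pair 𝕜) : ‖p‖ ^ 2 = ‖p.fst‖ ^ 2 + ‖p.snd‖ ^ 2 :=
  WithLp.prod_norm_sq_eq_of_L2 p

theorem sum_oscBound_le {L : ℝ} (hL : ∀ e, G.length e ≤ L) (hL0 : 0 ≤ L) (p : G.L2Pair 𝕜)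
    (S : Finset E) : ∑ e ∈ S, oscBound p e ≤ (1 + 2 * L) * ‖p‖ ^ 2 := by
  have h : ∀ e ∈ S, oscBound p e ≤ ‖p.fst e‖ ^ 2 + (1 + 2 * L) * ‖p.snd e‖ ^ 2 := fun e _ => by
    unfold oscBound
    have := mul_le_mul_of_nonneg_right (hL e) (sq_nonneg ‖p.snd e‖)
    nlinarith [sq_nonneg (‖p.fst e‖ - ‖p.snd e‖)]
  refine (Finset.sum_le_sum h).trans ?_
  rw [Finset.sum_add_distrib, ← Finset.mul_sum, norm_sq_eq]
  have h1 := sum_norm_sq_le p.fst S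
  have h2 := mul_le_mul_of_nonneg_left (sum_norm_sq_le p.snd S) (by linarith : 0 ≤ 1 + 2 * L)
  have h3 : 0 ≤ L * ‖p.fst‖ ^ 2 := by positivity
  linarith

namespace IsSobolev

variable {f : G.Point → 𝕜} {p : G.L2Pair 𝕜}

theorem norm_sq_le_add_oscBound (hf : G.IsSobolev f p) (e : E) {x y : ℝ}
    (hx : x ∈ Icc 0 (G.length e)) (hy : y ∈ Icc 0 (G.length e)) :
    ‖f (G.edgeMap e x)‖ ^ 2 ≤ ‖f (G.edgeMap e y)‖ ^ 2 + oscBound p e := by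
  have h1 := hf.norm_mul_sqrt_le e hx
  have h2 := hf.norm_mul_sqrt_le e hy
  have h3 := (norm_sub_norm_le _ _).trans (hf.norm_sub_le e hx hy)
  have h4 := mul_le_mul_of_nonneg_right h3
    (add_nonneg (norm_nonneg (f (G.edgeMap e x))) (norm_nonneg (f (G.edgeMap e y))))
  have h5 := mul_le_mul_of_nonneg_right (add_le_add h1 h2) (norm_nonneg (p.snd e))
  unfold oscBound
  linarith

theorem norm_fst_sq_le (hf : G.IsSobolev f p) (e : E) {y : ℝ} (hy : y ∈ Icc 0 (G.length e)) :
    ‖p.fst e‖ ^ 2 ≤ G.length e * (‖f (G.edgeMap e y)‖ ^ 2 + oscBound p e) := by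
  have h0 := oscBound_nonneg p e
  have h : ‖p.fst e‖ ≤ √(G.length e) * √(‖f (G.edgeMap e y)‖ ^ 2 + oscBound p e) := by
    refine norm_le_sqrt_length_mul _ (by positivity) ?_
    filter_upwards [hf.ae_eq e, ae_mem_Ioo e] with x h1 h2
    rw [h1]
    exact Real.le_sqrt_of_sq_le (hf.norm_sq_le_add_oscBound e (Ioo_subset_Icc_self h2) hy)
  have h1 := pow_le_pow_left₀ (norm_nonneg _) h 2
  rwa [mul_pow, Real.sq_sqrt (G.length_pos e).le, Real.sq_sqrt (by positivity)] at h1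

theorem norm_sq_vertex_le (hf : G.IsSobolev f p) (e : E) (b b' : Bool) :
    ‖f (G.vertexPt (G.endpoint e b))‖ ^ 2 ≤
      ‖f (G.vertexPt (G.endpoint e b'))‖ ^ 2 + oscBound p e := by
  obtain ⟨x, hx, hx'⟩ := exists_edgeMap_eq_vertexPt (G := G) e b
  obtain ⟨y, hy, hy'⟩ := exists_edgeMap_eq_vertexPt (G := G) e b'
  rw [← hx', ← hy']
  exact hf.norm_sq_le_add_oscBound e hx hy

theorem norm_fst_sq_le_vertex (hf : G.IsSobolev f p) (e : E) (b : Bool) :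
    ‖p.fst e‖ ^ 2 ≤ G.length e * (‖f (G.vertexPt (G.endpoint e b))‖ ^ 2 + oscBound p e) := by
  obtain ⟨y, hy, hy'⟩ := exists_edgeMap_eq_vertexPt (G := G) e b
  rw [← hy']
  exact hf.norm_fst_sq_le e hy

end IsSobolev

/-! ### Approximation by step functions -/

theorem memLp_step (e : E) (h : ℝ) {N : ℕ} (c : Fin (N + 1) → 𝕜) :
    MemLp (fun x : ℝ => c (Fin.ofNat (N + 1) ⌊x / h⌋₊)) 2 (G.edgeMeasure e) := by
  refine MemLp.of_bound (C := ‖c‖) ?_ (ae_of_all _ fun x => norm_le_pi_norm c _)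
  exact ((measurable_from_nat (f := fun k => c (Fin.ofNat (N + 1) k))).comp
    (Nat.measurable_floor.comp (measurable_id.div_const h))).aestronglyMeasurable

/-- The step function on the edge `e` with steps of length `h`. -/
noncomputable def stepMap (e : E) (h : ℝ) (N : ℕ) :
    (Fin (N + 1) → 𝕜) →ₗ[𝕜] Lp 𝕜 2 (G.edgeMeasure e) where
  toFun c := (memLp_step e h c).toLp _
  map_add' c c' := (MemLp.toLp_add (memLp_step e h c) (memLp_step e h c'))
  map_smul' a c := (MemLp.toLp_const_smul a (memLp_step e h c))

variable (𝕜) in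
theorem exists_finiteDimensional_edge (e : E) {η : ℝ} (hη : 0 < η) :
    ∃ W : Submodule 𝕜 (Lp 𝕜 2 (G.edgeMeasure e)), FiniteDimensional 𝕜 W ∧
      ∀ (f : G.Point → 𝕜) (p : G.L2Pair 𝕜), G.IsSobolev f p →
        ∃ w ∈ W, ‖p.fst e - w‖ ≤ η * ‖p.snd e‖ := by
  have hℓ := G.length_pos e
  obtain ⟨N, hN⟩ := exists_nat_gt ((G.length e / η) ^ 2)
  set h : ℝ := G.length e / (N + 1) with hh
  have hN0 : (0 : ℝ) < N + 1 := by positivity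
  have hpos : 0 < h := by positivity
  refine ⟨LinearMap.range (stepMap (𝕜 := 𝕜) e h N), inferInstance, fun f p hf =>
    ⟨_, ⟨fun i => f (G.edgeMap e (i * h)), rfl⟩, ?_⟩⟩
  have hbound : √(G.length e) * √h ≤ η := by
    rw [← Real.sqrt_mul hℓ.le]
    refine Real.sqrt_le_iff.2 ⟨hη.le, ?_⟩
    rw [hh, mul_div_assoc', div_le_iff₀ hN0]
    rw [div_pow, div_lt_iff₀ (by positivity)] at hN
    nlinarith [sq_nonneg η]
  refine le_trans (norm_le_sqrt_length_mul _ (by positivity : 0 ≤ √h * ‖p.snd e‖) ?_) ?_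
  · filter_upwards [Lp.coeFn_sub (p.fst e) (stepMap e h N fun i => f (G.edgeMap e (i * h))),
      (memLp_step (G := G) e h (N := N) fun i => f (G.edgeMap e (i * h))).coeFn_toLp,
      hf.ae_eq e, ae_mem_Ioo e] with x h1 h2 h3 h4
    have h2' : stepMap (𝕜 := 𝕜) e h N (fun i => f (G.edgeMap e (i * h))) x = _ := h2
    rw [h1, Pi.sub_apply, h3, h2']
    have hx0 : 0 ≤ x / h := div_nonneg h4.1.le hpos.le
    have hle : (⌊x / h⌋₊ : ℝ) * h ≤ x := by
      rw [← le_div_iff₀ hpos]; exact Nat.floor_le hx0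
    have hlt : x < (⌊x / h⌋₊ + 1) * h := by
      rw [← div_lt_iff₀ hpos]; exact Nat.lt_floor_add_one _
    have hk : ⌊x / h⌋₊ < N + 1 := by
      rw [Nat.floor_lt hx0, div_lt_iff₀ hpos, hh]
      push_cast
      rw [mul_div_cancel₀ _ hN0.ne']
      exact h4.2
    have hval : ((Fin.ofNat (N + 1) ⌊x / h⌋₊ : Fin (N + 1)) : ℕ) = ⌊x / h⌋₊ :=
      Nat.mod_eq_of_lt hk
    rw [hval]
    refine (hf.norm_sub_le_sqrt e ⟨by positivity, hle.trans h4.2.le⟩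
      (Ioo_subset_Icc_self h4) hle).trans ?_
    exact mul_le_mul_of_nonneg_right (Real.sqrt_le_sqrt (by linarith)) (norm_nonneg _)
  · rw [← mul_assoc]
    exact mul_le_mul_of_nonneg_right hbound (norm_nonneg _)

end MetricGraph

namespace MetricGraph

variable {V E : Type*} {G : MetricGraph V E}

/-- Only vertices are glued: two edges meet in vertices at most. -/
theorem exists_endCoord_of_pt_eq {e e' : E} {x : Icc (0 : ℝ) (G.length e)}
    {x' : Icc (0 : ℝ) (G.length e')} (h : G.pt e x = G.pt e' x') (hne : e ≠ e') :
    ∃ b, x = G.endCoord e b := by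
  have hb := congrArg (bump (𝕜 := ℝ) e (fun t => t * (G.length e - t)) (by simp) (by simp)) h
  rw [bump_pt_self, bump_pt_ne _ _ _ _ hne.symm] at hb
  have hb : (x : ℝ) * (G.length e - x) = 0 := hb
  rcases mul_eq_zero.1 hb with h | h
  · exact ⟨false, Subtype.ext h⟩
  · exact ⟨true, Subtype.ext (sub_eq_zero.1 h).symm⟩

theorem endCoord_injective (e : E) : Function.Injective (G.endCoord e) := by
  intro b b' h
  have h' := congrArg Subtype.val h
  have := G.length_pos e
  cases b <;> cases b' <;> simp [endCoord] at h' ⊢ <;> linarith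

/-- Different vertices are different points. -/
theorem vertexPt_injective : Function.Injective G.vertexPt := by
  intro v w h
  let F : G.Point → V → Prop := Quot.lift
    (fun p v => ∃ b, p.2 = G.endCoord p.1 b ∧ G.endpoint p.1 b = v) (by
      rintro p q ⟨e, b, e', b', rfl, rfl, hee⟩
      funext v
      refine propext ⟨?_, ?_⟩
      · rintro ⟨b₁, h1, h2⟩
        exact ⟨b', rfl, by rw [← hee, endCoord_injective _ h1, h2]⟩
      · rintro ⟨b₁, h1, h2⟩
        exact ⟨b, rfl, by rw [hee, endCoord_injective _ h1, h2]⟩)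
  obtain ⟨e, b, rfl⟩ := G.exists_endpoint v
  obtain ⟨e', b', rfl⟩ := G.exists_endpoint w
  rw [← pt_endCoord, ← pt_endCoord] at h
  have h1 : F (G.pt e (G.endCoord e b)) (G.endpoint e b) := ⟨b, rfl, rfl⟩
  rw [h] at h1
  obtain ⟨b₁, h2, h3⟩ := h1
  have h2 : b' = b₁ := endCoord_injective _ h2
  subst h2
  exact h3.symm

/-- A union of closed edges is closed. -/
theorem isClosed_iUnion_range_pt (S : Set E) : IsClosed {q | ∃ e ∈ S, ∃ x, G.pt e x = q} := by
  have hq : IsQuotientMap (Quot.mk G.Glue) := isQuotientMap_quot_mk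
  refine hq.isClosed_preimage.1 (isClosed_sigma_iff.2 ?_)
  intro e
  by_cases he : e ∈ S
  · convert isClosed_univ
    exact eq_univ_of_forall fun x => ⟨e, he, x, rfl⟩
  · refine ((finite_range (G.endCoord e)).subset ?_).isClosed
    rintro x ⟨e', he', x', hx'⟩
    obtain ⟨b, hb⟩ := exists_endCoord_of_pt_eq (G := G) (e := e) (x := x) hx'.symm
      fun h => he (h ▸ he')
    exact ⟨b, hb.symm⟩

theorem exists_common_endpoint_of_pt_eq {e e' : E} {x : Icc (0 : ℝ) (G.length e)}
    {x' : Icc (0 : ℝ) (G.length e')} (h : G.pt e x = G.pt e' x') (hne : e ≠ e') :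
    ∃ b b', G.endpoint e b = G.endpoint e' b' := by
  obtain ⟨b, hb⟩ := exists_endCoord_of_pt_eq h hne
  obtain ⟨b', hb'⟩ := exists_endCoord_of_pt_eq h.symm hne.symm
  refine ⟨b, b', vertexPt_injective (G := G) ?_⟩
  rw [← pt_endCoord, ← pt_endCoord, ← hb, ← hb', h]

namespace Rooting

variable (R : G.Rooting)

/-- The edge `e` is `c` or lies behind `c`, seen from the root. -/
def Behind (c e : E) : Prop := Relation.ReflTransGen (fun e e' => R.src e' = R.dst e) c e

variable {R}

theorem Behind.depth_le {c e : E} (h : R.Behind c e) :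
    R.depth (R.dst c) ≤ R.depth (R.dst e) := by
  induction h with
  | refl => exact le_rfl
  | @tail _ e _ h ih =>
    have := R.depth_dst e
    rw [h] at this
    omega

theorem Behind.eq_or_exists {c e : E} (h : R.Behind c e) :
    e = c ∨ ∃ e', R.Behind c e' ∧ R.src e = R.dst e' := by
  rcases Relation.ReflTransGen.cases_tail h with h | ⟨e', h1, h2⟩
  · exact Or.inl h
  · exact Or.inr ⟨e', h1, h2⟩

theorem src_ne_dst_of_behind {c e : E} (h : R.Behind c e) : R.src c ≠ R.dst e := by
  intro heq
  have h1 := h.depth_le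
  have h2 := R.depth_dst c
  rw [heq] at h2
  omega

variable (R)

open Classical in
/-- The height of a vertex above the starting point of `c`, cut off at the other end of `c`. -/
noncomputable def vertexHeight (c : E) (v : V) : ℝ :=
  if ∃ e, R.Behind c e ∧ R.dst e = v then G.length c else 0

theorem vertexHeight_dst_of_behind {c e : E} (h : R.Behind c e) :
    R.vertexHeight c (R.dst e) = G.length c := if_pos ⟨e, h, rfl⟩

theorem vertexHeight_dst_of_not_behind {c e : E} (h : ¬ R.Behind c e) :
    R.vertexHeight c (R.dst e) = 0 :=
  if_neg fun ⟨_, h1, h2⟩ => h (R.dst_injective h2 ▸ h1)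

theorem vertexHeight_src_self (c : E) : R.vertexHeight c (R.src c) = 0 :=
  if_neg fun ⟨_, h1, h2⟩ => src_ne_dst_of_behind h1 h2.symm

theorem vertexHeight_src_of_behind {c e : E} (h : R.Behind c e) (hne : e ≠ c) :
    R.vertexHeight c (R.src e) = G.length c := by
  rcases h.eq_or_exists with h | ⟨e', h1, h2⟩
  · exact absurd h hne
  · exact if_pos ⟨e', h1, h2.symm⟩

theorem vertexHeight_src_of_not_behind {c e : E} (h : ¬ R.Behind c e) :
    R.vertexHeight c (R.src e) = 0 :=
  if_neg fun ⟨_, h1, h2⟩ => h (h1.tail h2.symm)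

open Classical in
/-- The height above the starting point of `c` on the edge `e`. -/
noncomputable def edgeHeight (c e : E) (x : ℝ) : ℝ :=
  if e = c then if R.head e then x else G.length e - x
  else if R.Behind c e then G.length c else 0

theorem edgeHeight_endCoord (c e : E) (b : Bool) :
    R.edgeHeight c e (G.endCoord e b) = R.vertexHeight c (G.endpoint e b) := by
  unfold edgeHeight
  by_cases hec : e = c
  · subst hec
    rw [if_pos rfl]
    rcases R.endpoint_eq e b with ⟨h1, h2⟩ | ⟨h1, h2⟩
    · rw [h1, R.vertexHeight_dst_of_behind Relation.ReflTransGen.refl, h2]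
      cases R.head e <;> simp [endCoord]
    · rw [h1, R.vertexHeight_src_self, h2]
      cases R.head e <;> simp [endCoord]
  · rw [if_neg hec]
    by_cases hb : R.Behind c e
    · rw [if_pos hb]
      rcases R.endpoint_eq e b with ⟨h1, -⟩ | ⟨h1, -⟩
      · rw [h1, R.vertexHeight_dst_of_behind hb]
      · rw [h1, R.vertexHeight_src_of_behind hb hec]
    · rw [if_neg hb]
      rcases R.endpoint_eq e b with ⟨h1, -⟩ | ⟨h1, -⟩
      · rw [h1, R.vertexHeight_dst_of_not_behind hb]
      · rw [h1, R.vertexHeight_src_of_not_behind hb]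

/-- The height of a point above the starting point of `c`, cut off at the other end of `c`. -/
noncomputable def height (c : E) : G.Point → ℝ :=
  Quot.lift (fun p => R.edgeHeight c p.1 p.2) (by
    rintro p q ⟨e, b, e', b', rfl, rfl, h⟩
    dsimp only
    rw [R.edgeHeight_endCoord, R.edgeHeight_endCoord, h])

theorem height_pt (c e : E) (x : Icc (0 : ℝ) (G.length e)) :
    R.height c (G.pt e x) = R.edgeHeight c e x := rfl

theorem height_vertexPt (c : E) (v : V) : R.height c (G.vertexPt v) = R.vertexHeight c v := by
  obtain ⟨e, b, rfl⟩ := G.exists_endpoint v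
  rw [← pt_endCoord, height_pt, edgeHeight_endCoord]

theorem continuous_height (c : E) : Continuous (R.height c) := by
  refine continuous_quot_lift _ (continuous_sigma fun e => ?_)
  unfold edgeHeight
  dsimp only
  split_ifs
  · exact continuous_subtype_val
  · exact continuous_const.sub continuous_subtype_val
  · exact continuous_const
  · exact continuous_const

/-- The part of `G` behind the starting point of the edge `c`. -/
def branch (c : E) : Set G.Point := {q | 0 < R.height c q}

theorem isOpen_branch (c : E) : IsOpen (R.branch c) :=
  isOpen_lt continuous_const (R.continuous_height c)

theorem height_pt_of_behind {c e : E} (h : R.Behind c e) (hne : e ≠ c)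
    (x : Icc (0 : ℝ) (G.length e)) : R.height c (G.pt e x) = G.length c := by
  rw [height_pt, edgeHeight, if_neg hne, if_pos h]

theorem exists_of_mem_branch {c : E} {q : G.Point} (h : q ∈ R.branch c) :
    ∃ e, R.Behind c e ∧ ∃ x, G.pt e x = q := by
  induction q using Quot.ind with
  | mk p =>
    obtain ⟨e, x⟩ := p
    refine ⟨e, ?_, x, rfl⟩
    by_contra hb
    have h : 0 < R.edgeHeight c e x := h
    rw [edgeHeight, if_neg (by rintro rfl; exact hb .refl), if_neg hb] at h
    exact lt_irrefl _ h

theorem closure_branch_subset (c : E) :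
    closure (R.branch c) ⊆ {q | ∃ e ∈ {e | R.Behind c e}, ∃ x, G.pt e x = q} :=
  closure_minimal (fun _ h => R.exists_of_mem_branch h) (isClosed_iUnion_range_pt _)

theorem frontier_branch_subset (c : E) : frontier (R.branch c) ⊆ {G.vertexPt (R.src c)} := by
  rintro q ⟨h1, h2⟩
  rw [(R.isOpen_branch c).interior_eq] at h2
  obtain ⟨e, he, x, rfl⟩ := R.closure_branch_subset c h1
  have he : R.Behind c e := he
  by_cases hec : e = c
  · subst hec
    have h2 : ¬ 0 < R.edgeHeight e e x := h2
    rw [edgeHeight, if_pos rfl] at h2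
    have hx : x = G.endCoord e (!R.head e) := by
      refine Subtype.ext ?_
      cases hh : R.head e
      · rw [hh] at h2
        simp only [Bool.false_eq_true, if_false] at h2
        exact le_antisymm x.2.2 (show G.length e ≤ x by linarith)
      · rw [hh] at h2
        simp only [if_true] at h2
        exact le_antisymm (not_lt.1 h2) x.2.1
    rw [hx, pt_endCoord]
    rfl
  · exact absurd (show 0 < R.height c _ by
      rw [R.height_pt_of_behind he hec]; exact G.length_pos c) h2

theorem isCompact_frontier_branch (c : E) : IsCompact (frontier (R.branch c)) :=
  ((finite_singleton _).subset (R.frontier_branch_subset c)).isCompact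

theorem vertexPt_dst_mem_branch {c e : E} (h : R.Behind c e) :
    G.vertexPt (R.dst e) ∈ R.branch c := by
  change 0 < R.height c _
  rw [height_vertexPt, R.vertexHeight_dst_of_behind h]
  exact G.length_pos c

theorem isConnected_branch (c : E) : IsConnected (R.branch c) := by
  have hconn : ∀ e, IsPreconnected (range (G.pt e)) := fun e => by
    have : PreconnectedSpace (Icc (0 : ℝ) (G.length e)) :=
      Subtype.preconnectedSpace isPreconnected_Icc
    exact isPreconnected_range (continuous_pt e)
  have hbase : ∀ e, R.Behind c e → ∃ t ⊆ R.branch c, G.vertexPt (R.dst c) ∈ t ∧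
      G.vertexPt (R.dst e) ∈ t ∧ IsPreconnected t := by
    intro e he
    induction he with
    | refl =>
      exact ⟨{G.vertexPt (R.dst c)}, singleton_subset_iff.2 (R.vertexPt_dst_mem_branch .refl),
        rfl, rfl, isPreconnected_singleton⟩
    | @tail e e' he hee ih =>
      obtain ⟨t, ht, h1, h2, h3⟩ := ih
      have hne : e' ≠ c := by
        rintro rfl
        exact src_ne_dst_of_behind he hee
      refine ⟨t ∪ range (G.pt e'), union_subset ht ?_, Or.inl h1, Or.inr ?_,
        h3.union (G.vertexPt (R.dst e)) h2 ?_ (hconn e')⟩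
      · rintro _ ⟨x, rfl⟩
        change 0 < R.height c _
        rw [R.height_pt_of_behind (he.tail hee) hne]
        exact G.length_pos c
      · exact ⟨G.endCoord e' (R.head e'), pt_endCoord _ _⟩
      · exact ⟨G.endCoord e' (!R.head e'), by rw [pt_endCoord]; exact congrArg _ hee⟩
  refine ⟨⟨_, R.vertexPt_dst_mem_branch .refl⟩,
    isPreconnected_of_forall (G.vertexPt (R.dst c)) fun q hq => ?_⟩
  obtain ⟨e, he, x, rfl⟩ := R.exists_of_mem_branch hq
  by_cases hec : e = c
  · subst hec
    have hq : 0 < R.edgeHeight e e x := hq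
    have hpre : IsPreconnected {y | y ∈ Icc 0 (G.length e) ∧ 0 < R.edgeHeight e e y} := by
      simp only [edgeHeight, if_true]
      cases R.head e
      · simp only [Bool.false_eq_true, if_false, sub_pos]
        exact (ordConnected_Icc.inter ordConnected_Iio).isPreconnected
      · simp only [if_true]
        exact (ordConnected_Icc.inter ordConnected_Ioi).isPreconnected
    have hmap : ∀ y : Icc (0 : ℝ) (G.length e), G.edgeMap e y = G.pt e y := fun y => by
      rw [edgeMap, projIcc_val]
    refine ⟨G.edgeMap e '' {y | y ∈ Icc 0 (G.length e) ∧ 0 < R.edgeHeight e e y}, ?_, ?_,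
      ⟨x, ⟨x.2, hq⟩, hmap x⟩,
      hpre.image _ (continuous_edgeMap e).continuousOn⟩
    · rintro _ ⟨y, ⟨hy, hy'⟩, rfl⟩
      rw [hmap ⟨y, hy⟩]
      exact hy'
    · refine ⟨G.endCoord e (R.head e), ⟨(G.endCoord e (R.head e)).2, ?_⟩,
        (hmap _).trans (pt_endCoord _ _)⟩
      rw [R.edgeHeight_endCoord]
      change 0 < R.vertexHeight e (R.dst e)
      rw [R.vertexHeight_dst_of_behind .refl]
      exact G.length_pos e
  · rcases he.eq_or_exists with h | ⟨e', he', hee⟩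
    · exact absurd h hec
    · obtain ⟨t, ht, h1, h2, h3⟩ := hbase e' he'
      refine ⟨t ∪ range (G.pt e), union_subset ht ?_, Or.inl h1, Or.inr ⟨x, rfl⟩,
        h3.union (G.vertexPt (R.dst e')) h2 ?_ (hconn e)⟩
      · rintro _ ⟨x, rfl⟩
        change 0 < R.height c _
        rw [R.height_pt_of_behind he hec]
        exact G.length_pos c
      · exact ⟨G.endCoord e (!R.head e), by rw [pt_endCoord]; exact congrArg _ hee⟩

theorem branch_subset_branch {c c' : E} (h : R.src c' = R.dst c) :
    R.branch c' ⊆ R.branch c := by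
  intro q hq
  obtain ⟨e, he, x, rfl⟩ := R.exists_of_mem_branch hq
  have hce : R.Behind c e := Relation.ReflTransGen.head h he
  have hne : e ≠ c := by
    rintro rfl
    exact src_ne_dst_of_behind (R := R) he h
  change 0 < R.height c _
  rw [R.height_pt_of_behind hce hne]
  exact G.length_pos c

/-- The end of `G` to which a ray leads. -/
def rayEnd (c : ℕ → E) (hc : ∀ n, R.src (c (n + 1)) = R.dst (c n)) : G.EndRep where
  U n := R.branch (c n)
  isOpen n := R.isOpen_branch _
  isConnected n := R.isConnected_branch _
  isCompact_frontier n := R.isCompact_frontier_branch _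
  succ_subset n := R.branch_subset_branch (hc n)
  iInter_closure := by
    refine eq_empty_of_forall_notMem fun q hq => ?_
    obtain ⟨e, x, hx, rfl⟩ := exists_edgeMap_eq q
    have hdepth : ∀ n, n ≤ R.depth (R.dst (c n)) := by
      intro n
      induction n with
      | zero => exact Nat.zero_le _
      | succ n ih =>
        rw [R.depth_dst, hc]
        exact Nat.succ_le_succ ih
    have hend : ∀ e b, R.depth (G.endpoint e b) ≤ R.depth (R.dst e) ∧
        R.depth (R.dst e) ≤ R.depth (G.endpoint e b) + 1 := by
      intro e b
      have := R.depth_dst e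
      rcases R.endpoint_eq e b with ⟨h, -⟩ | ⟨h, -⟩ <;> rw [h] <;> omega
    obtain ⟨e', he', x', hx'⟩ :=
      R.closure_branch_subset _ (mem_iInter.1 hq (R.depth (R.dst e) + 2))
    have h1 := (hdepth _).trans (Behind.depth_le (R := R) he')
    by_cases hee : e' = e
    · rw [hee] at h1; omega
    · obtain ⟨b, b', h2⟩ := exists_common_endpoint_of_pt_eq hx' hee
      have h3 := hend e' b
      have h4 := hend e b'
      rw [h2] at h3
      omega

/-- König's lemma. -/
theorem exists_ray_of_infinite (hfin : G.LocallyFinite) {P : Set E} (hP : P.Infinite) :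
    ∃ c : ℕ → E, (∀ n, R.src (c (n + 1)) = R.dst (c n)) ∧
      ∀ n, (P ∩ {e | R.Behind (c n) e}).Infinite := by
  have hchild : ∀ v, {e | R.src e = v}.Finite := fun v =>
    (R.finite_edges_of_finite hfin (finite_singleton v)).subset fun e he => Or.inl he
  have hroot : ∀ e, ∃ c, R.src c = R.root ∧ R.Behind c e := by
    intro e
    induction hn : R.depth (R.dst e) generalizing e with
    | zero => rw [R.depth_dst] at hn; omega
    | succ n ih =>
      rcases R.eq_root_or_exists_dst (R.src e) with h | ⟨e', h⟩
      · exact ⟨e, h, .refl⟩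
      · obtain ⟨c, hc, hce⟩ := ih e' (by rw [R.depth_dst, ← h] at hn; omega)
        exact ⟨c, hc, hce.tail h.symm⟩
  have hstart : ∃ c, (P ∩ {e | R.Behind c e}).Infinite := by
    by_contra! h
    refine hP (((hchild R.root).biUnion fun c _ => h c).subset fun e he => ?_)
    obtain ⟨c, hc, hce⟩ := hroot e
    exact mem_biUnion (show c ∈ {e | R.src e = R.root} from hc) ⟨he, hce⟩
  have hstep : ∀ c, (P ∩ {e | R.Behind c e}).Infinite →
      ∃ c', R.src c' = R.dst c ∧ (P ∩ {e | R.Behind c' e}).Infinite := by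
    intro c hc
    by_contra! h
    refine hc (((finite_singleton c).union ((hchild (R.dst c)).biUnion fun c' hc' =>
      h c' hc')).subset fun e he => ?_)
    rcases Relation.ReflTransGen.cases_head he.2 with h | ⟨c', h1, h2⟩
    · exact Or.inl h.symm
    · exact Or.inr (mem_biUnion (show c' ∈ {e | R.src e = R.dst c} from h1) ⟨he.1, h2⟩)
  obtain ⟨c₀, hc₀⟩ := hstart
  choose! g hg1 hg2 using hstep
  let c : ℕ → E := fun n => g^[n] c₀
  have hinf : ∀ n, (P ∩ {e | R.Behind (c n) e}).Infinite := by
    intro n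
    induction n with
    | zero => exact hc₀
    | succ n ih =>
      change (P ∩ {e | R.Behind (g^[n + 1] c₀) e}).Infinite
      rw [Function.iterate_succ_apply']
      exact hg2 _ ih
  refine ⟨c, fun n => ?_, hinf⟩
  change R.src (g^[n + 1] c₀) = _
  rw [Function.iterate_succ_apply']
  exact hg1 _ (hinf n)

/-- A function that vanishes at all ends is small at all but finitely many vertices. -/
theorem finite_le_of_tendsto_topEnd (hfin : G.LocallyFinite) {F : Type*} [NormedAddCommGroup F]
    {f : G.Point → F} (hf : ∀ γ : G.TopEnd, Tendsto f γ.nhds (𝓝 0)) {δ : ℝ} (hδ : 0 < δ) :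
    {e | δ ≤ ‖f (G.vertexPt (R.dst e))‖}.Finite := by
  by_contra hinf
  obtain ⟨c, hc, hc'⟩ := R.exists_ray_of_infinite hfin hinf
  have ht : Tendsto f (⨅ n, 𝓟 (R.branch (c n))) (𝓝 0) := hf ⟦R.rayEnd c hc⟧
  have hanti : Antitone fun n => R.branch (c n) :=
    antitone_nat_of_succ_le fun n => R.branch_subset_branch (hc n)
  have hb := hasBasis_iInf_principal (s := fun n => R.branch (c n)) hanti.directed_ge
  have hev := ht.eventually (Metric.ball_mem_nhds 0 hδ)
  obtain ⟨n, -, hn⟩ := hb.eventually_iff.1 hev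
  obtain ⟨e, he1, he2⟩ := (hc' n).nonempty
  have h1 := hn (R.vertexPt_dst_mem_branch he2)
  rw [dist_zero_right] at h1
  exact absurd he1 (not_le.2 h1)

end Rooting

end MetricGraph

namespace MetricGraph

variable {V E : Type*} {G : MetricGraph V E} {𝕜 : Type*} [RCLike 𝕜]

theorem IsSobolev.sub {f g : G.Point → 𝕜} {p q : G.L2Pair 𝕜} (hf : G.IsSobolev f p)
    (hg : G.IsSobolev g q) : G.IsSobolev (f - g) (p - q) := by
  simpa [sub_eq_add_neg] using hf.add (hg.smul (-1))

theorem norm_fst_apply_le (p : G.L2Pair 𝕜) (e : E) : ‖p.fst e‖ ≤ ‖p‖ :=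
  (lp.norm_apply_le_norm (by norm_num) p.fst e).trans (WithLp.norm_fst_le _ p)

theorem norm_snd_apply_le (p : G.L2Pair 𝕜) (e : E) : ‖p.snd e‖ ≤ ‖p‖ :=
  (lp.norm_apply_le_norm (by norm_num) p.snd e).trans (WithLp.norm_snd_le _ p)

namespace Rooting

variable (R : G.Rooting)

theorem exists_finset_norm_sq_le (v : V) : ∃ A : Finset E, ∀ (f : G.Point → 𝕜) (p : G.L2Pair 𝕜),
    G.IsSobolev f p →
      ‖f (G.vertexPt v)‖ ^ 2 ≤ ‖f (G.vertexPt R.root)‖ ^ 2 + ∑ e ∈ A, oscBound p e := by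
  classical
  suffices h : ∃ A : Finset E, (∀ e ∈ A, R.depth (R.dst e) ≤ R.depth v) ∧
      ∀ (f : G.Point → 𝕜) (p : G.L2Pair 𝕜), G.IsSobolev f p →
        ‖f (G.vertexPt v)‖ ^ 2 ≤ ‖f (G.vertexPt R.root)‖ ^ 2 + ∑ e ∈ A, oscBound p e by
    obtain ⟨A, -, hA⟩ := h
    exact ⟨A, hA⟩
  induction hn : R.depth v generalizing v with
  | zero =>
    rcases R.eq_root_or_exists_dst v with rfl | ⟨e, rfl⟩
    · exact ⟨∅, by simp, fun f p _ => by simp⟩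
    · rw [R.depth_dst] at hn; omega
  | succ n ih =>
    rcases R.eq_root_or_exists_dst v with rfl | ⟨e, rfl⟩
    · exact ⟨∅, by simp, fun f p _ => by simp⟩
    · have hn' : R.depth (R.src e) = n := by rw [R.depth_dst] at hn; omega
      obtain ⟨A, hA, hA'⟩ := ih (R.src e) hn'
      have heA : e ∉ A := fun he => by have := hA e he; omega
      refine ⟨insert e A, fun e' he' => ?_, fun f p hf => ?_⟩
      · rcases Finset.mem_insert.1 he' with rfl | he'
        · exact hn.le
        · exact (hA e' he').trans (Nat.le_succ n)
      · rw [Finset.sum_insert heA]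
        have h1 : ‖f (G.vertexPt (R.dst e))‖ ^ 2 ≤
            ‖f (G.vertexPt (R.src e))‖ ^ 2 + oscBound p e := hf.norm_sq_vertex_le e _ _
        have h2 := hA' f p hf
        linarith

variable (𝕜) in
/-- The supremum norm is controlled by the `H¹` norm. -/
theorem exists_norm_le (R : G.Rooting) {L : ℝ} (hL0 : 0 ≤ L) (hL : ∀ e, G.length e ≤ L) :
    ∃ C : ℝ, 0 ≤ C ∧ ∀ (f : G.Point → 𝕜) (p : G.L2Pair 𝕜), G.IsSobolev f p →
      ∀ q, ‖f q‖ ≤ C * ‖p‖ := by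
  obtain ⟨e₀, b₀, h₀⟩ := G.exists_endpoint R.root
  have hs : 0 < √(G.length e₀) := Real.sqrt_pos.2 (G.length_pos e₀)
  set D : ℝ := (1 + G.length e₀) / √(G.length e₀) with hD
  refine ⟨√(D ^ 2 + 2 * (1 + 2 * L)), Real.sqrt_nonneg _, fun f p hf q => ?_⟩
  obtain ⟨e, x, hx, rfl⟩ := exists_edgeMap_eq q
  obtain ⟨y, hy, hy'⟩ := exists_edgeMap_eq_vertexPt (G := G) e (R.head e)
  have hroot : ‖f (G.vertexPt R.root)‖ ≤ D * ‖p‖ := by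
    obtain ⟨z, hz, hz'⟩ := exists_edgeMap_eq_vertexPt (G := G) e₀ b₀
    rw [h₀] at hz'
    rw [← hz', hD, div_mul_eq_mul_div, le_div_iff₀ hs]
    refine (hf.norm_mul_sqrt_le e₀ hz).trans ?_
    have h1 := norm_fst_apply_le p e₀
    have h2 := mul_le_mul_of_nonneg_left (norm_snd_apply_le p e₀) (G.length_pos e₀).le
    linarith
  have hroot2 := pow_le_pow_left₀ (norm_nonneg _) hroot 2
  obtain ⟨A, hA⟩ := R.exists_finset_norm_sq_le (𝕜 := 𝕜) (R.dst e)
  have h1 := hA f p hf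
  have h2 := hf.norm_sq_le_add_oscBound e hx hy
  rw [hy'] at h2
  have h3 := sum_oscBound_le hL hL0 p A
  have h4 := sum_oscBound_le hL hL0 p {e}
  rw [Finset.sum_singleton] at h4
  have h5 : ‖f (G.edgeMap e x)‖ ^ 2 ≤ (D ^ 2 + 2 * (1 + 2 * L)) * ‖p‖ ^ 2 := by
    change _ ≤ ‖f (G.vertexPt (R.dst e))‖ ^ 2 + _ at h2
    rw [mul_pow] at hroot2
    linarith
  refine (Real.le_sqrt_of_sq_le h5).trans (le_of_eq ?_)
  rw [Real.sqrt_mul (by positivity), Real.sqrt_sq (norm_nonneg _)]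

/-- Functions in `H¹` that vanish at the ends and leaves have uniformly small tails. -/
theorem sum_norm_fst_sq_le (hfin : G.LocallyFinite) {L : ℝ} (hL0 : 0 ≤ L)
    (hL : ∀ e, G.length e ≤ L) {N : ℕ} {ε : ℝ} (hε : 0 ≤ ε) (hseg : R.TailsLE N ε)
    {f : G.Point → 𝕜} {p : G.L2Pair 𝕜} (hf : G.IsSobolev f p)
    (hv : G.VanishesOn G.endsAndLeaves f) (S : Finset E) (hS : ∀ e ∈ S, N < R.depth (R.dst e)) :
    ∑ e ∈ S, ‖p.fst e‖ ^ 2 ≤ 3 * ε * ((1 + 2 * L) * ‖p‖ ^ 2) := by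
  obtain ⟨a, ha0, ha1, -⟩ := R.exists_offset hε hseg
  have h1 := R.sum_length_mul_le hfin hε hseg (U := fun v => ‖f (G.vertexPt v)‖ ^ 2)
    (fun v hdeg => by
      obtain ⟨e, b, rfl⟩ := G.exists_endpoint v
      rw [← pt_endCoord, hv.vertex e b (Or.inr ⟨_, hdeg, rfl⟩), norm_zero]
      norm_num)
    (fun δ hδ => by
      refine (R.finite_le_of_tendsto_topEnd hfin
        (fun γ => hv.topEnd γ (Or.inl ⟨γ, rfl⟩)) (Real.sqrt_pos.2 hδ)).subset fun e he => ?_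
      exact Real.sqrt_le_iff.2 ⟨norm_nonneg _, he⟩)
    (oscBound_nonneg p) (fun e => hf.norm_sq_vertex_le e _ _)
    (fun S => sum_oscBound_le hL hL0 p S) S hS
  have h2 : ∑ e ∈ S, ‖p.fst e‖ ^ 2 ≤
      ∑ e ∈ S, (G.length e * ‖f (G.vertexPt (R.dst e))‖ ^ 2 + ε * oscBound p e) := by
    refine Finset.sum_le_sum fun e he => (hf.norm_fst_sq_le_vertex e (R.head e)).trans ?_
    have hle : G.length e ≤ ε := by linarith [ha0 e, ha1 e (hS e he)]
    have := mul_le_mul_of_nonneg_right hle (oscBound_nonneg p e)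
    change G.length e * (‖f (G.vertexPt (R.dst e))‖ ^ 2 + _) ≤ _
    linarith
  rw [Finset.sum_add_distrib, ← Finset.mul_sum] at h2
  have h3 := mul_le_mul_of_nonneg_left (sum_oscBound_le hL hL0 p S) hε
  linarith

end Rooting

/-! ### Completeness of the form domain -/

theorem norm_integral_sub_le {e : E} (w w' : Lp 𝕜 2 (G.edgeMeasure e)) {x : ℝ}
    (hx : x ∈ Icc 0 (G.length e)) :
    ‖(∫ t in 0..x, w t) - ∫ t in 0..x, w' t‖ ≤ √(x - 0) * ‖w - w'‖ := by
  rw [← intervalIntegral.integral_sub (intervalIntegrable_coe _ hx) (intervalIntegrable_coe _ hx)]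
  have h := intervalIntegral_congr_edge (Lp.coeFn_sub w w') hx
  simp only [Pi.sub_apply] at h
  rw [← h]
  exact norm_integral_le _ le_rfl hx.1 hx.2

theorem isSobolev_of_tendsto {f : ℕ → G.Point → 𝕜} {p : ℕ → G.L2Pair 𝕜} {g : G.Point → 𝕜}
    {q : G.L2Pair 𝕜} (hf : ∀ n, G.IsSobolev (f n) (p n)) (hp : Tendsto p atTop (𝓝 q))
    (hg : TendstoUniformly f g atTop) : G.IsSobolev g q := by
  have hcont : Continuous g := hg.continuous (Frequently.of_forall fun n => (hf n).continuous)
  have hpt : ∀ y, Tendsto (fun n => f n y) atTop (𝓝 (g y)) := fun y => hg.tendsto_at y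
  have hfst : ∀ e, Tendsto (fun n => ‖(p n).fst e - q.fst e‖) atTop (𝓝 0) := fun e =>
    squeeze_zero (fun n => norm_nonneg _) (fun n => norm_fst_apply_le (p n - q) e)
      (tendsto_iff_norm_sub_tendsto_zero.1 hp)
  have hsnd : ∀ e, Tendsto (fun n => ‖(p n).snd e - q.snd e‖) atTop (𝓝 0) := fun e =>
    squeeze_zero (fun n => norm_nonneg _) (fun n => norm_snd_apply_le (p n - q) e)
      (tendsto_iff_norm_sub_tendsto_zero.1 hp)
  refine ⟨hcont, fun e => ?_, fun e x hx => ?_⟩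
  · have hce : Continuous fun x => g (G.edgeMap e x) := hcont.comp (continuous_edgeMap e)
    obtain ⟨M, hM⟩ := isCompact_Icc.exists_bound_of_continuousOn (s := Icc 0 (G.length e))
      hce.continuousOn
    have hmem : MemLp (fun x => g (G.edgeMap e x)) 2 (G.edgeMeasure e) := by
      refine MemLp.of_bound hce.aestronglyMeasurable M ?_
      filter_upwards [ae_mem_Ioo e] with x hx
      exact hM x (Ioo_subset_Icc_self hx)
    have hlim : Tendsto (fun n => (p n).fst e) atTop (𝓝 (hmem.toLp _)) := by
      refine tendsto_iff_norm_sub_tendsto_zero.2 ?_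
      refine Metric.tendsto_atTop.2 fun ε hε => ?_
      set ε' := ε / (2 * (√(G.length e) + 1)) with hε'
      have hpos : 0 < ε' := by positivity
      obtain ⟨n₀, hn₀⟩ := eventually_atTop.1 (Metric.tendstoUniformly_iff.1 hg ε' hpos)
      refine ⟨n₀, fun n hn => ?_⟩
      rw [dist_zero_right, norm_norm]
      have : ‖(p n).fst e - hmem.toLp _‖ ≤ √(G.length e) * ε' := by
        refine norm_le_sqrt_length_mul _ hpos.le ?_
        filter_upwards [Lp.coeFn_sub ((p n).fst e) (hmem.toLp _), (hf n).ae_eq e,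
          hmem.coeFn_toLp] with x h1 h2 h3
        rw [h1, Pi.sub_apply, h2, h3, ← dist_eq_norm, dist_comm]
        exact (hn₀ n hn _).le
      refine this.trans_lt ?_
      rw [hε', mul_div_assoc', div_lt_iff₀ (by positivity)]
      nlinarith [Real.sqrt_nonneg (G.length e)]
    have heq := tendsto_nhds_unique (tendsto_iff_norm_sub_tendsto_zero.2 (hfst e)) hlim
    rw [heq]
    exact hmem.coeFn_toLp
  · have hI : Tendsto (fun n => ∫ t in 0..x, (p n).snd e t) atTop
        (𝓝 (∫ t in 0..x, q.snd e t)) := by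
      refine tendsto_iff_norm_sub_tendsto_zero.2 (squeeze_zero (fun n => norm_nonneg _)
        (fun n => norm_integral_sub_le _ _ hx) ?_)
      simpa using (hsnd e).const_mul √(x - 0)
    refine tendsto_nhds_unique (hpt _) ?_
    exact ((hpt _).add hI).congr fun n => ((hf n).eq_integral e x hx).symm

theorem vanishesOn_of_tendstoUniformly {𝔙 : Set (V ⊕ G.TopEnd)} {f : ℕ → G.Point → 𝕜}
    {g : G.Point → 𝕜} (hf : ∀ n, G.VanishesOn 𝔙 (f n)) (hg : TendstoUniformly f g atTop) :
    G.VanishesOn 𝔙 g where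
  vertex e b h := by
    refine tendsto_nhds_unique (hg.tendsto_at _) ?_
    simp only [fun n => (hf n).vertex e b h]
    exact tendsto_const_nhds
  topEnd γ h := by
    refine Metric.tendsto_nhds.2 fun ε hε => ?_
    obtain ⟨n, hn⟩ := (Metric.tendstoUniformly_iff.1 hg (ε / 2) (half_pos hε)).exists
    filter_upwards [Metric.tendsto_nhds.1 ((hf n).topEnd γ h) (ε / 2) (half_pos hε)] with y hy
    have := dist_triangle (g y) (f n y) 0
    have := hn y
    linarith

theorem isClosed_H10 {C : ℝ} (hC0 : 0 ≤ C)
    (hC : ∀ (f : G.Point → 𝕜) (p : G.L2Pair 𝕜), G.IsSobolev f p → ∀ q, ‖f q‖ ≤ C * ‖p‖)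
    (𝔙 : Set (V ⊕ G.TopEnd)) : IsClosed (G.H10 𝕜 𝔙 : Set (G.L2Pair 𝕜)) := by
  refine IsSeqClosed.isClosed fun p q hp hpq => ?_
  choose f hf hf' using hp
  have hcauchy : UniformCauchySeqOn f atTop univ := by
    refine Metric.uniformCauchySeqOn_iff.2 fun ε hε => ?_
    obtain ⟨n₀, hn₀⟩ := Metric.cauchySeq_iff.1 hpq.cauchySeq (ε / (C + 1)) (by positivity)
    refine ⟨n₀, fun m hm n hn y _ => ?_⟩
    have h1 := hC _ _ ((hf m).sub (hf n)) y
    have h2 := hn₀ m hm n hn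
    rw [dist_eq_norm, lt_div_iff₀ (by positivity)] at h2
    rw [dist_eq_norm]
    have h3 : ‖f m y - f n y‖ ≤ C * ‖p m - p n‖ := h1
    linarith [norm_nonneg (p m - p n)]
  have hlim : ∀ y, ∃ z, Tendsto (fun n => f n y) atTop (𝓝 z) := fun y =>
    cauchySeq_tendsto_of_complete (hcauchy.cauchySeq (mem_univ y))
  choose g hg using hlim
  have hunif : TendstoUniformly f g atTop :=
    tendstoUniformlyOn_univ.1 (hcauchy.tendstoUniformlyOn_of_tendsto fun y _ => hg y)
  exact ⟨g, isSobolev_of_tendsto hf hpq hunif, vanishesOn_of_tendstoUniformly hf' hunif⟩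

/-! ### Compactness of the embedding -/

variable (G 𝕜) in
/-- The embedding of `H¹₀(G; 𝔙)` into `L²(G)` as a continuous linear map. -/
noncomputable def embeddingL (𝔙 : Set (V ⊕ G.TopEnd)) : G.H10 𝕜 𝔙 →L[𝕜] G.L2 𝕜 :=
  WithLp.fstL 2 𝕜 (G.L2 𝕜) (G.L2 𝕜) ∘L (G.H10 𝕜 𝔙).subtypeL

theorem norm_le_of_sum_norm_sq_le {u : G.L2 𝕜} {C : ℝ} (hC : 0 ≤ C)
    (h : ∀ S : Finset E, ∑ e ∈ S, ‖u e‖ ^ 2 ≤ C ^ 2) : ‖u‖ ≤ C :=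
  lp.norm_le_of_forall_sum_le (by norm_num) hC fun S => by simpa using h S

theorem isCompactOperator_embeddingL (hfin : G.LocallyFinite) (htree : G.IsTree)
    (hlength : ∀ s, G.segmentLength s < ⊤)
    (hsmall : ∀ ε : ℝ, 0 < ε → {s | ENNReal.ofReal ε < G.segmentLength s}.Finite) :
    IsCompactOperator (G.embeddingL 𝕜 G.endsAndLeaves) := by
  classical
  obtain ⟨R⟩ := htree.exists_rooting
  obtain ⟨L, hL0, hL⟩ := exists_length_le hlength hsmall
  refine isCompactOperator_of_finiteDimensional_approx _ fun η hη => ?_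
  set ε : ℝ := η ^ 2 / (6 * (1 + 2 * L)) with hε
  have hεpos : 0 < ε := by positivity
  obtain ⟨N, hN⟩ := R.exists_tailsLE hlength hsmall hεpos
  set F := (R.finite_edges_depth_le hfin N).toFinset with hF
  have hFmem : ∀ e, e ∉ F → N < R.depth (R.dst e) := fun e he => by
    simpa [hF] using he
  choose W hWfin hW using fun e => exists_finiteDimensional_edge (G := G) 𝕜 e (half_pos hη)
  have hfd : ∀ e, FiniteDimensional 𝕜 ((W e).map (lp.lsingle (𝕜 := 𝕜)
    (E := fun e => Lp 𝕜 2 (G.edgeMeasure e)) 2 e)) := fun e => inferInstance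
  refine ⟨F.sup fun e => (W e).map (lp.lsingle (𝕜 := 𝕜)
    (E := fun e => Lp 𝕜 2 (G.edgeMeasure e)) 2 e),
    Submodule.finiteDimensional_finset_sup _ _, fun p => ?_⟩
  obtain ⟨p, f, hf, hv⟩ := p
  choose w hw hpw using fun e => hW e f p hf
  refine ⟨∑ e ∈ F, lp.single 2 e (w e), Submodule.sum_mem _ fun e he => ?_, ?_⟩
  · exact (Finset.le_sup (f := fun e => (W e).map (lp.lsingle (𝕜 := 𝕜)
      (E := fun e => Lp 𝕜 2 (G.edgeMeasure e)) 2 e)) he) ⟨w e, hw e, rfl⟩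
  · change ‖p.fst - _‖ ≤ η * ‖p‖
    have hsum : ∀ e, (∑ e ∈ F, lp.single 2 e (w e) : G.L2 𝕜) e = if e ∈ F then w e else 0 := by
      intro e
      rw [lp.coeFn_sum, Finset.sum_apply]
      by_cases he : e ∈ F
      · rw [if_pos he, Finset.sum_eq_single e, lp.single_apply_self]
        · exact fun e' _ hne => lp.single_apply_ne _ _ _ hne.symm
        · exact fun h => absurd he h
      · rw [if_neg he]
        exact Finset.sum_eq_zero fun e' he' =>
          lp.single_apply_ne _ _ _ (by rintro rfl; exact he he')
    refine norm_le_of_sum_norm_sq_le (by positivity) fun S => ?_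
    have hsub : ∀ e, (p.fst - ∑ e ∈ F, lp.single 2 e (w e) : G.L2 𝕜) e =
        p.fst e - if e ∈ F then w e else 0 := fun e => by
      rw [lp.coeFn_sub, Pi.sub_apply, hsum]
    simp only [hsub]
    rw [← Finset.sum_filter_add_sum_filter_not S (· ∈ F)]
    have h1 : ∑ e ∈ S with e ∈ F, ‖p.fst e - if e ∈ F then w e else 0‖ ^ 2 ≤
        (η / 2) ^ 2 * ‖p‖ ^ 2 := by
      calc _ ≤ ∑ e ∈ S with e ∈ F, (η / 2) ^ 2 * ‖p.snd e‖ ^ 2 := by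
            refine Finset.sum_le_sum fun e he => ?_
            rw [if_pos (Finset.mem_filter.1 he).2, ← mul_pow]
            exact pow_le_pow_left₀ (norm_nonneg _) (hpw e) 2
        _ ≤ (η / 2) ^ 2 * ‖p‖ ^ 2 := by
            rw [← Finset.mul_sum]
            refine mul_le_mul_of_nonneg_left ((sum_norm_sq_le p.snd _).trans ?_) (sq_nonneg _)
            exact pow_le_pow_left₀ (norm_nonneg _) (WithLp.norm_snd_le _ p) 2
    have h2 : ∑ e ∈ S with e ∉ F, ‖p.fst e - if e ∈ F then w e else 0‖ ^ 2 ≤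
        η ^ 2 / 2 * ‖p‖ ^ 2 := by
      calc _ = ∑ e ∈ S with e ∉ F, ‖p.fst e‖ ^ 2 := Finset.sum_congr rfl fun e he => by
            rw [if_neg (Finset.mem_filter.1 he).2, sub_zero]
        _ ≤ 3 * ε * ((1 + 2 * L) * ‖p‖ ^ 2) :=
            R.sum_norm_fst_sq_le hfin hL0.le hL hεpos.le hN hf hv _ fun e he =>
              hFmem e (Finset.mem_filter.1 he).2
        _ = η ^ 2 / 2 * ‖p‖ ^ 2 := by
            rw [hε]
            field_simp
            ring
    have h3 : 0 ≤ η ^ 2 * ‖p‖ ^ 2 := by positivity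
    rw [mul_pow]
    linarith

/-! ### The Laplacian -/

theorem mem_laplacianGraph_iff {𝔙 : Set (V ⊕ G.TopEnd)} [CompleteSpace (G.H10 𝕜 𝔙)]
    (x y : G.L2 𝕜) : (x, y) ∈ G.laplacianGraph 𝕜 𝔙 ↔
      x = (G.embeddingL 𝕜 𝔙 ∘L (G.embeddingL 𝕜 𝔙).adjoint) (x + y) := by
  have hinner : ∀ φ p : G.H10 𝕜 𝔙, ⟪φ, p⟫_𝕜 =
      ⟪(φ : G.L2Pair 𝕜).fst, (p : G.L2Pair 𝕜).fst⟫_𝕜 +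
        ⟪(φ : G.L2Pair 𝕜).snd, (p : G.L2Pair 𝕜).snd⟫_𝕜 := fun φ p =>
    WithLp.prod_inner_apply _ _
  have hJ : ∀ φ : G.H10 𝕜 𝔙, G.embeddingL 𝕜 𝔙 φ = (φ : G.L2Pair 𝕜).fst := fun φ => rfl
  constructor
  · rintro ⟨p, hp, h1, h2⟩
    have h1 : p.fst = x := h1
    have h2 : ∀ φ ∈ G.H10 𝕜 𝔙, ⟪φ.snd, p.snd⟫_𝕜 = ⟪φ.fst, y⟫_𝕜 := h2
    have : (G.embeddingL 𝕜 𝔙).adjoint (x + y) = ⟨p, hp⟩ := by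
      refine ext_inner_left 𝕜 fun φ => ?_
      rw [ContinuousLinearMap.adjoint_inner_right, hJ, hinner, inner_add_right,
        h2 _ φ.2, h1]
    rw [ContinuousLinearMap.comp_apply, this, hJ, h1]
  · intro h
    set p := (G.embeddingL 𝕜 𝔙).adjoint (x + y) with hp
    have hx : (p : G.L2Pair 𝕜).fst = x := h.symm
    refine ⟨p, p.2, hx, fun φ hφ => ?_⟩
    have h1 : ⟪(⟨φ, hφ⟩ : G.H10 𝕜 𝔙), p⟫_𝕜 = ⟪φ.fst, x + y⟫_𝕜 := by
      rw [hp, ContinuousLinearMap.adjoint_inner_right, hJ]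
    rw [hinner, inner_add_right, hx] at h1
    exact add_left_cancel h1

end MetricGraph

theorem mainTheorem11 {V E : Type*} [Countable E] (𝕜 : Type*) [RCLike 𝕜] (G : MetricGraph V E)
    (hfin : G.LocallyFinite) (htree : G.IsTree)
    (hlength : ∀ s, G.segmentLength s < ⊤)
    (hsmall : ∀ ε : ℝ, 0 < ε → {s | ENNReal.ofReal ε < G.segmentLength s}.Finite) :
    IsCompactOperator (G.embedding 𝕜 G.endsAndLeaves) ∧
      HasPurelyDiscreteSpectrum (G.laplacian 𝕜 G.endsAndLeaves) := by
  have hJ := G.isCompactOperator_embeddingL (𝕜 := 𝕜) hfin htree hlength hsmall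
  refine ⟨hJ, ?_⟩
  obtain ⟨R⟩ := htree.exists_rooting
  obtain ⟨L, hL0, hL⟩ := MetricGraph.exists_length_le hlength hsmall
  obtain ⟨C, hC0, hC⟩ := R.exists_norm_le 𝕜 hL0.le hL
  have hclosed := MetricGraph.isClosed_H10 hC0 hC G.endsAndLeaves
  have : CompleteSpace (G.H10 𝕜 G.endsAndLeaves) := hclosed.completeSpace_coe
  refine hasPurelyDiscreteSpectrum_of_graph_eq_comp_adjoint _ hJ fun x y => ?_
  rw [MetricGraph.laplacian_graph]
  exact MetricGraph.mem_laplacianGraph_iff x y
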